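/- **Notions.** For probability measures $P,Q$ on the same space and $\varepsilon\in\mathbb R$ let $\mathscr D_{e^\varepsilon}(P\|Q)=\sup_S\,(P(S)-e^{\varepsilon}Q(S))$, the supremum over measurable sets $S$. Write $(P',Q')\preceq(P,Q)$, "$(P',Q')$ is dominated by $(P,Q)$", if $\mathscr D_{e^\varepsilon}(P'\|Q')\le\mathscr D_{e^\varepsilon}(P\|Q)$ for all $\varepsilon\in\mathbb R$. Two datasets (or batches) are adjacent if one is obtained from the other by removing one example. A mechanism $M$ is $(\varepsilon,\delta)$-DP if $\Pr[M(D)\in S]\le e^\varepsilon\Pr[M(D')\in S]+\delta$ for all adjacent $D,D'$ (in both orders) and all measurable $S$. For a vector or matrix $x$ with $\ell_2$ (Frobenius) norm $\|x\|$ and $C>0$, $[x]_C=x/\max(1,\|x\|/C)$. **DP-AdaFEST.** The parameters are tables $\theta\in\mathbb R^{c\times d}$. Given are $\eta,\tau\in\mathbb R$, $C_1,C_2,\sigma_1,\sigma_2>0$, and for each example $x$ a measurable per-example gradient map $\theta\mapsto g(x,\theta)\in\mathbb R^{c\times d}$. The contribution map of $g\in\mathbb R^{c\times d}$ is $v(g)\in\{0,1\}^c$,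 $v(g)[j]=\mathbf 1[g[j,:]\ne 0]$. For $V\in\mathbb R^c$ let $\mathrm{mask}_V(g)$ be $g$ with all rows $j$ such that $V[j]<\tau$ set to $0$. One step with mini-batch $B$ at parameters $\theta$ releases $$V=\sum_{x\in B}[v(g(x,\theta))]_{C_1}+C_1\,\mathcal N(0,\sigma_1^2I_c),\qquad G=\sum_{x\in B}[\mathrm{mask}_V(g(x,\theta))]_{C_2}+C_2\,\mathcal N\bigl(0,\sigma_2^2\,\mathrm{diag}((\mathbf 1[V[j]\ge\tau])_{j\in[c]}\otimes 1_d)\bigr),$$ and then updates $\theta\leftarrow\theta-\eta G$. The algorithm draws $\theta_0$ from a fixed probability measure and runs $T\ge 0$ steps, where each mini-batch is a fresh Poisson subsample of the dataset (each example is included independently with probability $\gamma\in(0,1]$) and all noise is independent. Its transcript is $(\theta_0,(V_t,G_t)_{t\le T})$ and its output is $\theta_T$. **DP-SGD** with noise multiplier $\sigma$, clipping norm $C>0$, learning rate $\eta$ and fixed nominal batch size $b\ge1$ is defined likewise (parameters in $\mathbb R^m$, measurable per-example gradient maps, random initialization, fresh Poisson subsamples $B_t$ with rate $\gamma$): step $t$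 releases $\hat g_t=\frac1b\bigl(\sum_{x\in B_t}[g(x,\theta)]_C+\mathcal N(0,\sigma^2C^2I)\bigr)$ and updates $\theta\leftarrow\theta-\eta\hat g_t$; its transcript is $(\theta_0,(\hat g_t)_{t\le T})$. **Theorem.** Let $\sigma=(\sigma_1^{-2}+\sigma_2^{-2})^{-1/2}$, $P=(1-\gamma)\mathcal N(0,\sigma^2)+\gamma\mathcal N(1,\sigma^2)$ and $Q=\mathcal N(0,\sigma^2)$. 1. For all $\theta$ and all adjacent batches $B,B'$ (in both orders), the pair of laws of $V$ is dominated by $(\mathcal N(1,\sigma_1^2),\mathcal N(0,\sigma_1^2))$; and for each fixed value of $V$, the pair of laws of $G$ given $V$ is dominated by $(\mathcal N(1,\sigma_2^2),\mathcal N(0,\sigma_2^2))$. 2. The pairs $(\mathcal N(1,\sigma_1^2)\times\mathcal N(1,\sigma_2^2),\ \mathcal N(0,\sigma_1^2)\times\mathcal N(0,\sigma_2^2))$ and $(\mathcal N(1,\sigma^2),\mathcal N(0,\sigma^2))$ have the same divergence $\mathscr D_{e^\varepsilon}$ for every $\varepsilon\in\mathbb R$; and for all $\theta$ and all adjacent batches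 (in both orders) the pair of joint laws of the releases $(V,G)$ of one step is dominated by $(\mathcal N(1,\sigma^2),\mathcal N(0,\sigma^2))$. 3. Let $D,D'$ be datasets such that $D'$ is $D$ with one example removed. If $M$ is the transcript of DP-AdaFEST, or its output $\theta_T$, then $(M(D),M(D'))\preceq(P^{\times T},Q^{\times T})$ and $(M(D'),M(D))\preceq(Q^{\times T},P^{\times T})$. 4. The same two dominations hold for the transcript of DP-SGD with noise multiplier $\sigma$, the same $\gamma$ and $T$, and any other inputs. 5. For all $\varepsilon,\delta\in\mathbb R$, if $\max\{\mathscr D_{e^\varepsilon}(P^{\times T}\|Q^{\times T}),\mathscr D_{e^\varepsilon}(Q^{\times T}\|P^{\times T})\}\le\delta$, then the transcript and the output of DP-AdaFEST are $(\varepsilon,\delta)$-DP. 6. The privacy cost of DP-AdaFEST is no more than that of DP-SGD with noise multiplier $\sigma$: for any learning rate, clipping norm $C>0$ and nominal batch size $b\ge1$ and all $\varepsilon,\delta\in\mathbb R$, if the transcript of DP-SGD on $\mathbb R^{c\times d}$ with noise multiplier $\sigma$, the same $\gamma$, $T$ and law of $\theta_0$ is $(\varepsilon,\delta)$-DP for every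 choice of the measurable per-example gradient maps, then the transcript and the output of DP-AdaFEST are $(\varepsilon,\delta)$-DP. -/

import Mathlib

open MeasureTheory ProbabilityTheory

namespace DPTraining

noncomputable section

/-! ### Hockey-stick divergence, dominating pairs, differential privacy -/

/-- The `e^ε`-hockey-stick divergence `sup_S P(S) - e^ε Q(S)`, over measurable events `S`. -/
def hockeyStick {Ω : Type*} [MeasurableSpace Ω] (ε : ℝ) (P Q : Measure Ω) : ℝ :=
  ⨆ S : {S : Set Ω // MeasurableSet S}, (P.real S.1 - Real.exp ε * Q.real S.1)

/-- `(P', Q') ⪯ (P, Q)`: the pair `(P', Q')` is dominated by the pair `(P, Q)`. -/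
def DominatedBy {Ω' Ω : Type*} [MeasurableSpace Ω'] [MeasurableSpace Ω]
    (P' Q' : Measure Ω') (P Q : Measure Ω) : Prop :=
  ∀ ε : ℝ, hockeyStick ε P' Q' ≤ hockeyStick ε P Q

/-- `(ε, δ)`-differential privacy, under adding or removing one example, of a mechanism that maps
a dataset of any size to the law of its output. -/
def IsDP {α Ω : Type*} [MeasurableSpace Ω] (ε δ : ℝ)
    (M : (n : ℕ) → (Fin n → α) → Measure Ω) : Prop :=
  ∀ (n : ℕ) (D : Fin (n + 1) → α) (i : Fin (n + 1)) (S : Set Ω), MeasurableSet S →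
    (M (n + 1) D).real S ≤ Real.exp ε * (M n (i.removeNth D)).real S + δ ∧
    (M n (i.removeNth D)).real S ≤ Real.exp ε * (M (n + 1) D).real S + δ

/-- The one-dimensional normal law `N(m, σ²)`. -/
def gauss (m σ : ℝ) : Measure ℝ := gaussianReal m (σ ^ 2).toNNReal

/-- The mixture `(1 - γ) N(0, σ²) + γ N(1, σ²)`. -/
def gaussMixture (γ σ : ℝ) : Measure ℝ :=
  ENNReal.ofReal (1 - γ) • gauss 0 σ + ENNReal.ofReal γ • gauss 1 σ

/-- The `T`-fold product measure `P^{×T}`. -/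
def prodPow (P : Measure ℝ) (T : ℕ) : Measure (Fin T → ℝ) := Measure.pi fun _ => P

/-! ### Clipping and Poisson subsampling -/

/-- `[x]_C = x / max (1, ‖x‖₂ / C)`. -/
def clip {ι : Type*} [Fintype ι] (C : ℝ) (x : EuclideanSpace ℝ ι) : EuclideanSpace ℝ ι :=
  (max 1 (‖x‖ / C))⁻¹ • x

/-- Independent inclusion bits, each equal to `true` with probability `γ`. -/
def inclusionLaw (γ : unitInterval) (n : ℕ) : Measure (Fin n → Bool) :=
  Measure.pi fun _ => bernoulliMeasure true false γ

/-- The mini-batch formed by the examples whose inclusion bit is `true`. -/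
def minibatch {α : Type*} {n : ℕ} (D : Fin n → α) (s : Fin n → Bool) : Multiset α :=
  (Finset.univ.filter fun i => s i = true).val.map D

/-! ### DP-AdaFEST -/

/-- Vectors indexed by the `c` feature buckets, with the `ℓ₂` norm. -/
abbrev BucketVec (c : ℕ) : Type := EuclideanSpace ℝ (Fin c)

/-- Embedding tables (`c` rows of length `d`), with the `ℓ₂` (Frobenius) norm. -/
abbrev Table (c d : ℕ) : Type := EuclideanSpace ℝ (Fin c × Fin d)

/-- The contribution map `v[j] = 1[g[j, :] ≠ 0]` of a per-example gradient `g`. -/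
def contributionMap {c d : ℕ} (g : Table c d) : BucketVec c :=
  open Classical in WithLp.toLp 2 fun j => if ∃ k, g (j, k) ≠ 0 then 1 else 0

/-- Set to zero all the rows `j` such that `V[j] < τ`. -/
def maskRows {c d : ℕ} (τ : ℝ) (V : BucketVec c) (g : Table c d) : Table c d :=
  WithLp.toLp 2 fun p => if V p.1 < τ then 0 else g p

/-- Input of DP-AdaFEST, apart from the dataset, the number of steps and the initialization:
learning rate, clipping norms, threshold, noise multipliers, and the per-example gradient
`grad x θ` of the example `x` at the parameters `θ`. -/
structure AdaFEST (α : Type*) (c d : ℕ) where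
  η : ℝ
  C₁ : ℝ
  C₂ : ℝ
  τ : ℝ
  σ₁ : ℝ
  σ₂ : ℝ
  grad : α → Table c d → Table c d

namespace AdaFEST

variable {α : Type*} {c d : ℕ}

/-- The noisy contribution map of a mini-batch `B`; `z₁` is a standard normal vector. -/
def noisyMap (A : AdaFEST α c d) (B : Multiset α) (θ : Table c d) (z₁ : BucketVec c) :
    BucketVec c :=
  (B.map fun x => clip A.C₁ (contributionMap (A.grad x θ))).sum + A.C₁ • (A.σ₁ • z₁)

/-- The noisy gradient of a mini-batch `B`, masked according to the noisy contribution map `V`;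
`z₂` is a standard normal vector, so that `σ₂ • maskRows τ V z₂` is a centred normal vector with
covariance `σ₂² diag (1[V[j] ≥ τ]) ⊗ 1_d`. -/
def noisyGrad (A : AdaFEST α c d) (B : Multiset α) (θ : Table c d) (V : BucketVec c)
    (z₂ : Table c d) : Table c d :=
  (B.map fun x => clip A.C₂ (maskRows A.τ V (A.grad x θ))).sum +
    A.C₂ • (A.σ₂ • maskRows A.τ V z₂)

/-- The two releases `(V, G)` of one step. -/
def step (A : AdaFEST α c d) (B : Multiset α) (θ : Table c d) (z₁ : BucketVec c)
    (z₂ : Table c d) : BucketVec c × Table c d :=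
  (A.noisyMap B θ z₁, A.noisyGrad B θ (A.noisyMap B θ z₁) z₂)

/-- The law of the noisy contribution map of the mini-batch `B` at `θ`. -/
def mapLaw (A : AdaFEST α c d) (B : Multiset α) (θ : Table c d) : Measure (BucketVec c) :=
  (stdGaussian (BucketVec c)).map (A.noisyMap B θ)

/-- The law of the masked noisy gradient of the mini-batch `B` at `θ`, given that the noisy
contribution map is `V`. -/
def gradLaw (A : AdaFEST α c d) (B : Multiset α) (θ : Table c d) (V : BucketVec c) :
    Measure (Table c d) :=
  (stdGaussian (Table c d)).map (A.noisyGrad B θ V)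

/-- The joint law of the two releases of one step with the mini-batch `B` at `θ`. -/
def stepLaw (A : AdaFEST α c d) (B : Multiset α) (θ : Table c d) :
    Measure (BucketVec c × Table c d) :=
  ((stdGaussian (BucketVec c)).prod (stdGaussian (Table c d))).map fun z => A.step B θ z.1 z.2

/-- A transcript of `T` steps: initial parameters and the releases `(V_t, G_t)` of all the steps. -/
abbrev Transcript (c d T : ℕ) : Type := Table c d × (Fin T → BucketVec c × Table c d)

/-- The parameters after `T` updates `θ ← θ - η G_t`. -/
def params (A : AdaFEST α c d) {T : ℕ} (h : Transcript c d T) : Table c d :=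
  h.1 - A.η • ∑ t, (h.2 t).2

/-- Append one more step, taken with the mini-batch `B` and the noise `z₁`, `z₂`. -/
def extend (A : AdaFEST α c d) {T : ℕ} (B : Multiset α) (z₁ : BucketVec c) (z₂ : Table c d)
    (h : Transcript c d T) : Transcript c d (T + 1) :=
  (h.1, Fin.snoc (α := fun _ => BucketVec c × Table c d) h.2 (A.step B (A.params h) z₁ z₂))

/-- The law of the transcript of `T` steps on the dataset `D`, with initial parameters drawn from
`μ₀`; each step uses a fresh Poisson subsample with rate `γ` and fresh Gaussian noise. -/
def transcriptLaw (A : AdaFEST α c d) (γ : unitInterval) (μ₀ : Measure (Table c d)) {n : ℕ}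
    (D : Fin n → α) : (T : ℕ) → Measure (Transcript c d T)
  | 0 => μ₀.map fun θ => (θ, Fin.elim0)
  | T + 1 =>
    ((A.transcriptLaw γ μ₀ D T).prod ((inclusionLaw γ n).prod
      ((stdGaussian (BucketVec c)).prod (stdGaussian (Table c d))))).map
        fun p => A.extend (minibatch D p.2.1) p.2.2.1 p.2.2.2 p.1

/-- The law of the trained parameters, the output of the algorithm after `T` steps. -/
def outputLaw (A : AdaFEST α c d) (γ : unitInterval) (μ₀ : Measure (Table c d)) (T : ℕ) {n : ℕ}
    (D : Fin n → α) : Measure (Table c d) :=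
  (A.transcriptLaw γ μ₀ D T).map A.params

end AdaFEST

/-! ### DP-SGD -/

/-- Input of DP-SGD, apart from the dataset, the number of steps and the initialization: learning
rate, clipping norm, noise multiplier, nominal batch size, and the per-example gradient. The nominal
batch size is a fixed normalization; the mini-batches themselves are Poisson subsamples. -/
structure DPSGD (α : Type*) (ι : Type*) [Fintype ι] where
  η : ℝ
  C : ℝ
  σ : ℝ
  b : ℕ
  grad : α → EuclideanSpace ℝ ι → EuclideanSpace ℝ ι

namespace DPSGD

variable {α ι : Type*} [Fintype ι]

/-- The private gradient of a mini-batch `B`; `z` is a standard normal vector. -/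
def noisyGrad (A : DPSGD α ι) (B : Multiset α) (θ z : EuclideanSpace ℝ ι) : EuclideanSpace ℝ ι :=
  (A.b : ℝ)⁻¹ • ((B.map fun x => clip A.C (A.grad x θ)).sum + A.C • (A.σ • z))

/-- Initial parameters and the private gradients of all the steps. -/
abbrev Transcript (ι : Type*) [Fintype ι] (T : ℕ) : Type _ :=
  EuclideanSpace ℝ ι × (Fin T → EuclideanSpace ℝ ι)

/-- The parameters after `T` updates `θ ← θ - η g_t`. -/
def params (A : DPSGD α ι) {T : ℕ} (h : Transcript ι T) : EuclideanSpace ℝ ι :=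
  h.1 - A.η • ∑ t, h.2 t

/-- Append one more step, taken with the mini-batch `B` and the noise `z`. -/
def extend (A : DPSGD α ι) {T : ℕ} (B : Multiset α) (z : EuclideanSpace ℝ ι)
    (h : Transcript ι T) : Transcript ι (T + 1) :=
  (h.1, Fin.snoc (α := fun _ => EuclideanSpace ℝ ι) h.2 (A.noisyGrad B (A.params h) z))

/-- The law of the transcript of `T` steps on the dataset `D`, with initial parameters drawn from
`μ₀`; each step uses a fresh Poisson subsample with rate `γ` and fresh Gaussian noise. -/
def transcriptLaw (A : DPSGD α ι) (γ : unitInterval) (μ₀ : Measure (EuclideanSpace ℝ ι)) {n : ℕ}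
    (D : Fin n → α) : (T : ℕ) → Measure (Transcript ι T)
  | 0 => μ₀.map fun θ => (θ, Fin.elim0)
  | T + 1 =>
    ((A.transcriptLaw γ μ₀ D T).prod ((inclusionLaw γ n).prod
      (stdGaussian (EuclideanSpace ℝ ι)))).map
        fun p => A.extend (minibatch D p.2.1) p.2.2 p.1

end DPSGD

end

end DPTraining

/-!
Every domination in the theorem is a data-processing inequality (`hockeyStick_comp_le`): the larger
pair of laws is mapped onto the smaller one by a single Markov kernel (`IsPostProcessing`).

For one Gaussian release the kernel is explicit. If `‖u‖ ≤ 1`, a scalar `z ~ N(m, σ²)` and an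
independent standard normal vector `w` give `z u + σ (1 - u uᵀ)^{1/2} w ~ N(m u, σ² I)`
(`map_spread`). With `u` the clipped gradient of the additional example, divided by the clipping
norm, the scalar laws `N(1, σ²)` and `N(0, σ²)` thus produce the releases of the batch with and
without that example. The other examples only shift the result, and masking is a linear map that
fixes `u`.

The scalar with noise level `σ` is the sufficient statistic of two scalars with noise levels `σ₁`
and `σ₂`: the precision-weighted mean goes one way (`map_weightedMean`), and independent noise goes
back (`map_split`). This is the equality of divergences for the two pairs, and it lets one scalar
drive both releases of a step (`AdaFEST.map_stepSim`); that the gradient is masked by the noisy map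
does no harm, since its kernel works for every value of the map.

Under Poisson subsampling one conditions on the inclusion of the other examples; the inclusion bit
of the distinguished example turns the scalar into one drawn from the mixture
(`map_bernoulli_prod`). These kernels are jointly measurable in the past transcript, so an
induction over the steps simulates the whole transcript, adaptively, from independent scalars
(`IsPostProcessing.subsampled_step`). The same kernel serves both orders of the pair.

For DP-SGD the dominating pair is attained: with constant gradients of norm `C` and the datasets
with one and with no example, a coordinate of the transcript has exactly the laws `P^{×T}` and
`Q^{×T}` (`DPSGD.map_transcriptLaw_const`). Hence an `(ε, δ)`-guarantee of DP-SGD for all gradients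
bounds the divergences of that pair, and with them those of DP-AdaFEST. An empty table admits no
such gradient, but then the releases do not depend on the data at all.
-/

namespace DPTraining

/-! ### Hockey-stick divergence under post-processing -/

section PostProcessing

variable {Ω Ω' : Type*} [MeasurableSpace Ω] [MeasurableSpace Ω']

lemma bddAbove_hockeyStick (ε : ℝ) (P Q : Measure Ω) [IsFiniteMeasure P] :
    BddAbove (Set.range fun S : {S : Set Ω // MeasurableSet S} =>
      P.real S.1 - Real.exp ε * Q.real S.1) := by
  refine ⟨P.real Set.univ, ?_⟩
  rintro _ ⟨S, rfl⟩
  have h1 : P.real S.1 ≤ P.real Set.univ := measureReal_mono (Set.subset_univ _)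
  have h2 : 0 ≤ Real.exp ε * Q.real S.1 := by positivity
  dsimp only
  linarith

lemma sub_le_hockeyStick (ε : ℝ) (P Q : Measure Ω) [IsFiniteMeasure P] {S : Set Ω}
    (hS : MeasurableSet S) : P.real S - Real.exp ε * Q.real S ≤ hockeyStick ε P Q :=
  le_ciSup (bddAbove_hockeyStick ε P Q) ⟨S, hS⟩

lemma hockeyStick_le {ε δ : ℝ} {P Q : Measure Ω}
    (h : ∀ S, MeasurableSet S → P.real S ≤ Real.exp ε * Q.real S + δ) :
    hockeyStick ε P Q ≤ δ := by
  have : Nonempty {S : Set Ω // MeasurableSet S} := ⟨⟨∅, .empty⟩⟩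
  refine ciSup_le fun S => ?_
  linarith [h S.1 S.2]

/-- Randomized tests do not beat deterministic ones: by the layer-cake formula, a `[0, 1]`-valued
test is an average of indicators of events. -/
lemma integral_sub_le_hockeyStick (ε : ℝ) (P Q : Measure Ω) [IsFiniteMeasure P]
    [IsFiniteMeasure Q] {f : Ω → ℝ} (hf : Measurable f) (h0 : ∀ x, 0 ≤ f x) (h1 : ∀ x, f x ≤ 1) :
    ∫ x, f x ∂P - Real.exp ε * ∫ x, f x ∂Q ≤ hockeyStick ε P Q := by
  have hint (μ : Measure Ω) [IsFiniteMeasure μ] : Integrable f μ :=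
    .of_bound hf.aestronglyMeasurable 1 (.of_forall fun x => by
      rw [Real.norm_eq_abs, abs_of_nonneg (h0 x)]; exact h1 x)
  have hcake (μ : Measure Ω) [IsFiniteMeasure μ] :
      ∫ x, f x ∂μ = ∫ t in Set.Ioc (0 : ℝ) 1, μ.real {a | t ≤ f a} :=
    (hint μ).integral_eq_integral_Ioc_meas_le (.of_forall h0) (.of_forall h1)
  have hcake_int (μ : Measure Ω) [IsFiniteMeasure μ] :
      IntegrableOn (fun t : ℝ => μ.real {a | t ≤ f a}) (Set.Ioc 0 1) := by
    have : Antitone fun t : ℝ => μ.real {a | t ≤ f a} := fun s t hst =>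
      measureReal_mono fun a (ha : t ≤ f a) => hst.trans ha
    exact ((this.antitoneOn _).integrableOn_isCompact isCompact_Icc).mono_set
      Set.Ioc_subset_Icc_self
  rw [hcake P, hcake Q, ← integral_const_mul, ← integral_sub (hcake_int P)
    ((hcake_int Q).const_mul _)]
  calc _ ≤ ∫ _ in Set.Ioc (0 : ℝ) 1, hockeyStick ε P Q := by
        refine integral_mono ((hcake_int P).sub ((hcake_int Q).const_mul _))
          (integrable_const _) fun t => ?_
        exact sub_le_hockeyStick ε P Q (measurableSet_le measurable_const hf)
    _ = hockeyStick ε P Q := by simp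

lemma hockeyStick_comp_le (ε : ℝ) (P Q : Measure Ω) [IsFiniteMeasure P] [IsFiniteMeasure Q]
    (κ : Kernel Ω Ω') [IsMarkovKernel κ] :
    hockeyStick ε (κ ∘ₘ P) (κ ∘ₘ Q) ≤ hockeyStick ε P Q := by
  refine hockeyStick_le fun S hS => ?_
  have hreal (μ : Measure Ω) : (κ ∘ₘ μ).real S = ∫ x, (κ x).real S ∂μ := by
    simp only [measureReal_def]
    rw [Measure.bind_apply hS κ.aemeasurable, integral_toReal]
    · exact (κ.measurable_coe hS).aemeasurable
    · exact .of_forall fun x => measure_lt_top _ _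
  have := integral_sub_le_hockeyStick ε P Q (f := fun x => (κ x).real S)
    (κ.measurable_coe hS).ennreal_toReal (fun x => measureReal_nonneg)
    (fun x => measureReal_le_one)
  rw [hreal, hreal]
  linarith

/-- The pair `(P', Q')` arises from `(P, Q)` by one and the same randomized map. -/
def IsPostProcessing (P' Q' : Measure Ω') (P Q : Measure Ω) : Prop :=
  ∃ κ : Kernel Ω Ω', IsMarkovKernel κ ∧ κ ∘ₘ P = P' ∧ κ ∘ₘ Q = Q'

namespace IsPostProcessing

variable {P Q : Measure Ω} {P' Q' : Measure Ω'}

lemma dominatedBy [IsFiniteMeasure P] [IsFiniteMeasure Q] (h : IsPostProcessing P' Q' P Q) :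
    DominatedBy P' Q' P Q := by
  obtain ⟨κ, _, rfl, rfl⟩ := h
  exact fun ε => hockeyStick_comp_le ε P Q κ

lemma symm (h : IsPostProcessing P' Q' P Q) : IsPostProcessing Q' P' Q P :=
  let ⟨κ, hκ, h1, h2⟩ := h
  ⟨κ, hκ, h2, h1⟩

lemma of_map {f : Ω → Ω'} (hf : Measurable f) (hP : P.map f = P') (hQ : Q.map f = Q') :
    IsPostProcessing P' Q' P Q :=
  ⟨Kernel.deterministic f hf, inferInstance, by rw [Measure.deterministic_comp_eq_map, hP],
    by rw [Measure.deterministic_comp_eq_map, hQ]⟩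

lemma trans {Ω'' : Type*} [MeasurableSpace Ω''] {P'' Q'' : Measure Ω''}
    (h' : IsPostProcessing P'' Q'' P' Q') (h : IsPostProcessing P' Q' P Q) :
    IsPostProcessing P'' Q'' P Q := by
  obtain ⟨κ, _, rfl, rfl⟩ := h
  obtain ⟨κ', _, rfl, rfl⟩ := h'
  exact ⟨κ' ∘ₖ κ, inferInstance, Measure.comp_assoc.symm, Measure.comp_assoc.symm⟩

lemma map {Ω'' : Type*} [MeasurableSpace Ω''] (h : IsPostProcessing P' Q' P Q) {f : Ω' → Ω''}
    (hf : Measurable f) : IsPostProcessing (P'.map f) (Q'.map f) P Q :=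
  (of_map hf rfl rfl).trans h

/-- Independent extra randomness is available to a post-processing. -/
lemma prod_noise {W : Type*} [MeasurableSpace W] (P Q : Measure Ω) [SFinite P] [SFinite Q]
    (ν : Measure W) [IsProbabilityMeasure ν] :
    IsPostProcessing (P.prod ν) (Q.prod ν) P Q :=
  ⟨Kernel.id ×ₖ Kernel.const Ω ν, inferInstance,
    by rw [← Measure.compProd_eq_comp_prod, Measure.compProd_const],
    by rw [← Measure.compProd_eq_comp_prod, Measure.compProd_const]⟩

lemma prod {Ω₂ Ω₂' : Type*} [MeasurableSpace Ω₂] [MeasurableSpace Ω₂'] {P₂ Q₂ : Measure Ω₂}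
    {P₂' Q₂' : Measure Ω₂'} [SFinite P] [SFinite Q] [SFinite P₂] [SFinite Q₂]
    (h : IsPostProcessing P' Q' P Q) (h₂ : IsPostProcessing P₂' Q₂' P₂ Q₂) :
    IsPostProcessing (P'.prod P₂') (Q'.prod Q₂') (P.prod P₂) (Q.prod Q₂) := by
  obtain ⟨κ, _, rfl, rfl⟩ := h
  obtain ⟨κ₂, _, rfl, rfl⟩ := h₂
  refine trans (P' := (κ ∘ₘ P).prod P₂) (Q' := (κ ∘ₘ Q).prod Q₂)
    ⟨Kernel.id ∥ₖ κ₂, inferInstance, ?_, ?_⟩ ⟨κ ∥ₖ Kernel.id, inferInstance, ?_, ?_⟩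
  · exact Measure.prod_comp_right.symm
  · exact Measure.prod_comp_right.symm
  · exact Measure.prod_comp_left.symm
  · exact Measure.prod_comp_left.symm

end IsPostProcessing

end PostProcessing

/-! ### Adaptive composition -/

section Adaptive

variable {X Y N W : Type*} [MeasurableSpace X] [MeasurableSpace Y] [MeasurableSpace N]
  [MeasurableSpace W]

/-- Two randomized maps with the same output law at every input have the same output law when the
input is random. -/
lemma map_prod_congr (ρ : Measure X) [SFinite ρ] (μ : Measure N) [SFinite μ] (ν : Measure W)
    [SFinite ν] {f : X × N → Y} {g : X × W → Y} (hf : Measurable f) (hg : Measurable g)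
    (h : ∀ x, μ.map (fun y => f (x, y)) = ν.map (fun y => g (x, y))) :
    (ρ.prod μ).map f = (ρ.prod ν).map g := by
  ext s hs
  rw [Measure.map_apply hf hs, Measure.map_apply hg hs, Measure.prod_apply (hf hs),
    Measure.prod_apply (hg hs)]
  refine lintegral_congr fun x => ?_
  have := DFunLike.congr_fun (h x) s
  rwa [Measure.map_apply (by fun_prop) hs, Measure.map_apply (by fun_prop) hs] at this

/-- One more step of an adaptive composition: if, at every state `x`, the pair of laws of the new
step is the image of `(P, Q)` and independent noise under a map `Φ (x, ·)`, measurable in `x` too,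
then one more copy of `(P, Q)` suffices to simulate it. -/
lemma IsPostProcessing.adaptive {Ω Z N' : Type*} [MeasurableSpace Ω] [MeasurableSpace Z]
    [MeasurableSpace N'] {P₀ Q₀ : Measure Ω} [SFinite P₀] [SFinite Q₀] {ρ ρ' : Measure X}
    [SFinite ρ] [SFinite ρ'] (h₀ : IsPostProcessing ρ ρ' P₀ Q₀)
    (P Q : Measure Z) [SFinite P] [SFinite Q] (ν : Measure W) [IsProbabilityMeasure ν]
    {μ : Measure N} {μ' : Measure N'} [SFinite μ] [SFinite μ']
    {f : X × N → Y} {f' : X × N' → Y} {Φ : X × (Z × W) → Y}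
    (hf : Measurable f) (hf' : Measurable f') (hΦ : Measurable Φ)
    (h : ∀ x, μ.map (fun y => f (x, y)) = (P.prod ν).map (fun y => Φ (x, y)))
    (h' : ∀ x, μ'.map (fun y => f' (x, y)) = (Q.prod ν).map (fun y => Φ (x, y))) :
    IsPostProcessing ((ρ.prod μ).map f) ((ρ'.prod μ').map f') (P₀.prod P) (Q₀.prod Q) := by
  rw [map_prod_congr ρ μ (P.prod ν) hf hΦ h, map_prod_congr ρ' μ' (Q.prod ν) hf' hΦ h']
  exact (h₀.prod (.prod_noise P Q ν)).map hΦ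

instance (P : Measure ℝ) [SigmaFinite P] (T : ℕ) : SigmaFinite (prodPow P T) := by
  unfold prodPow
  infer_instance

instance (P : Measure ℝ) [IsProbabilityMeasure P] (T : ℕ) :
    IsProbabilityMeasure (prodPow P T) := by
  unfold prodPow
  infer_instance

/-- The new factor is placed last in the pair and first in the power; as all the factors are equal,
their order is immaterial. -/
lemma IsPostProcessing.prodPow_succ (P Q : Measure ℝ) [SigmaFinite P] [SigmaFinite Q] (T : ℕ) :
    IsPostProcessing ((prodPow P T).prod P) ((prodPow Q T).prod Q) (prodPow P (T + 1))
      (prodPow Q (T + 1)) := by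
  have key (R : Measure ℝ) [SigmaFinite R] : (prodPow R (T + 1)).map
      (fun z => ((MeasurableEquiv.piFinSuccAbove (fun _ => ℝ) 0) z).swap) =
        (prodPow R T).prod R := by
    have h := (measurePreserving_piFinSuccAbove (fun _ : Fin (T + 1) => R) 0).map_eq
    rw [← Measure.prod_swap, prodPow, prodPow, ← h,
      Measure.map_map measurable_swap (MeasurableEquiv.measurable _)]
    rfl
  exact .of_map (measurable_swap.comp (MeasurableEquiv.measurable _)) (key P) (key Q)

end Adaptive

/-! ### Gaussian mechanisms as images of one-dimensional normal laws -/

section Gaussian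

instance (m σ : ℝ) : IsProbabilityMeasure (gauss m σ) := by unfold gauss; infer_instance

lemma charFun_gauss (m σ t : ℝ) :
    charFun (gauss m σ) t = Complex.exp (t * m * Complex.I - σ ^ 2 * t ^ 2 / 2) := by
  rw [gauss, charFun_gaussianReal, Real.coe_toNNReal _ (sq_nonneg σ)]
  push_cast
  ring_nf

/-- Reflection exchanges the two Gaussian laws, so that the order of the pair does not matter. -/
lemma IsPostProcessing.gauss_swap (σ : ℝ) :
    IsPostProcessing (gauss 0 σ) (gauss 1 σ) (gauss 1 σ) (gauss 0 σ) := by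
  refine .of_map (f := fun x => 1 - x) (by fun_prop) ?_ ?_ <;>
  · unfold gauss
    rw [gaussianReal_map_const_sub]
    norm_num

lemma IsPostProcessing.of_gauss_swap {Ω : Type*} [MeasurableSpace Ω] {P Q : Measure Ω} {σ : ℝ}
    (h : IsPostProcessing P Q (gauss 1 σ) (gauss 0 σ)) :
    IsPostProcessing Q P (gauss 1 σ) (gauss 0 σ) :=
  h.symm.trans (.gauss_swap σ)

variable {E : Type*} [NormedAddCommGroup E] [InnerProductSpace ℝ E]

/-- Transport of a scalar `z` with noise level `σ` along the vector `u`, `‖u‖ ≤ 1`, completed by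
independent noise `w` to isotropic noise of level `σ`. The linear map applied to `w` is the
square root of `1 - u uᵀ`; the form `1 + √(1 - ‖u‖²)` of the denominator keeps it nonzero
for `u = 0` also. -/
noncomputable def spread (σ : ℝ) (u : E) (p : ℝ × E) : E :=
  p.1 • u + σ • (p.2 - ((1 + √(1 - ‖u‖ ^ 2))⁻¹ * inner ℝ u p.2) • u)

lemma measurable_spread [MeasurableSpace E] [BorelSpace E] [SecondCountableTopology E] {X : Type*}
    [MeasurableSpace X] (σ : ℝ) {u : X → E} {p : X → ℝ × E} (hu : Measurable u)
    (hp : Measurable p) : Measurable fun x => spread σ (u x) (p x) := by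
  unfold spread
  fun_prop

/-- The linear map in `spread` is a square root of `1 - u uᵀ`. Only the norm of its values is
needed, as it determines the characteristic function of the noise. -/
lemma norm_sq_sqrt_one_sub (u t : E) (hu : ‖u‖ ≤ 1) :
    ‖t - ((1 + √(1 - ‖u‖ ^ 2))⁻¹ * inner ℝ u t) • u‖ ^ 2 = ‖t‖ ^ 2 - (inner ℝ u t) ^ 2 := by
  set r := √(1 - ‖u‖ ^ 2)
  have hr0 : 0 ≤ r := Real.sqrt_nonneg _
  have hr : ‖u‖ ^ 2 = 1 - r ^ 2 := by
    rw [Real.sq_sqrt (by nlinarith [norm_nonneg u])]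
    ring
  have : 1 + r ≠ 0 := by positivity
  rw [norm_sub_sq_real, inner_smul_right, norm_smul, mul_pow, Real.norm_eq_abs, sq_abs,
    real_inner_comm, hr]
  field_simp
  ring

variable [FiniteDimensional ℝ E] [MeasurableSpace E] [BorelSpace E]

lemma map_spread (m σ : ℝ) {u : E} (hu : ‖u‖ ≤ 1) :
    ((gauss m σ).prod (stdGaussian E)).map (spread σ u) =
      (stdGaussian E).map fun w => m • u + σ • w := by
  have hmeas : Measurable (spread σ u) := measurable_spread σ measurable_const measurable_id
  have := Measure.isProbabilityMeasure_map hmeas.aemeasurable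
    (μ := (gauss m σ).prod (stdGaussian E))
  have := Measure.isProbabilityMeasure_map (μ := stdGaussian E) (f := fun w => m • u + σ • w)
    (by fun_prop)
  refine Measure.ext_of_charFun (funext fun t => ?_)
  have hl (p : ℝ × E) : Complex.exp (inner ℝ (spread σ u p) t * Complex.I) =
      Complex.exp (inner ℝ p.1 (inner ℝ u t) * Complex.I) *
      Complex.exp (inner ℝ p.2
        (σ • (t - ((1 + √(1 - ‖u‖ ^ 2))⁻¹ * inner ℝ u t) • u)) * Complex.I) := by
    rw [← Complex.exp_add, ← add_mul, ← Complex.ofReal_add]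
    congr 3
    simp only [spread, inner_add_left, inner_smul_left, inner_smul_right, inner_sub_left,
      inner_sub_right, real_inner_comm u p.2, RCLike.inner_apply, conj_trivial]
    ring
  have hr (w : E) : Complex.exp (inner ℝ (m • u + σ • w) t * Complex.I) =
      Complex.exp (m * inner ℝ u t * Complex.I) *
        Complex.exp (inner ℝ w (σ • t) * Complex.I) := by
    rw [← Complex.exp_add, ← add_mul]
    congr 2
    simp only [inner_add_left, inner_smul_left, inner_smul_right, conj_trivial]
    push_cast
    ring
  have hc := norm_sq_sqrt_one_sub u t hu
  set v := t - ((1 + √(1 - ‖u‖ ^ 2))⁻¹ * inner ℝ u t) • u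
  have hc' : (‖v‖ : ℂ) ^ 2 = (‖t‖ : ℂ) ^ 2 - (inner ℝ u t : ℝ) ^ 2 := by exact_mod_cast hc
  rw [charFun_apply, charFun_apply, integral_map hmeas.aemeasurable (by fun_prop),
    integral_map (by fun_prop) (by fun_prop)]
  simp_rw [hl, hr]
  rw [integral_const_mul, ← charFun_apply, integral_prod_mul (μ := gauss m σ)
    (ν := stdGaussian E) (fun x => Complex.exp (inner ℝ x (inner ℝ u t) * Complex.I))
    (fun w => Complex.exp (inner ℝ w (σ • v) * Complex.I)), ← charFun_apply, ← charFun_apply,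
    charFun_stdGaussian, charFun_stdGaussian, charFun_gauss, ← Complex.exp_add,
    ← Complex.exp_add]
  congr 1
  have hn (x : E) : ((‖σ • x‖ : ℝ) : ℂ) ^ 2 = (σ : ℂ) ^ 2 * (‖x‖ : ℂ) ^ 2 := by
    rw [norm_smul, Complex.ofReal_mul, mul_pow, ← Complex.ofReal_pow, Real.norm_eq_abs, sq_abs,
      Complex.ofReal_pow]
  rw [hn, hn, hc']
  ring

/-- The scalar `z` has the law of the sufficient statistic of two independent observations with
noise levels `σ₁`, `σ₂`; independent noise turns it back into the two observations. The hypotheses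
say that the variances are `σ₁²` and `σ₂²`, and that the covariance `σ² - a b` vanishes. -/
lemma map_split {σ σ₁ σ₂ a b : ℝ} (ha : σ ^ 2 + a ^ 2 = σ₁ ^ 2) (hb : σ ^ 2 + b ^ 2 = σ₂ ^ 2)
    (hab : a * b = σ ^ 2) (m : ℝ) :
    ((gauss m σ).prod (gauss 0 1)).map (fun p => (p.1 + a * p.2, p.1 - b * p.2)) =
      (gauss m σ₁).prod (gauss m σ₂) := by
  have hmeas : Measurable fun p : ℝ × ℝ => (p.1 + a * p.2, p.1 - b * p.2) := by fun_prop
  have := Measure.isProbabilityMeasure_map hmeas.aemeasurable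
    (μ := (gauss m σ).prod (gauss 0 1))
  refine Measure.ext_of_charFunDual (funext fun L => ?_)
  obtain ⟨s, t, hL⟩ : ∃ s t : ℝ, ∀ x y, L (x, y) = s * x + t * y := by
    refine ⟨L (1, 0), L (0, 1), fun x y => ?_⟩
    have : ((x, y) : ℝ × ℝ) = x • (1, 0) + y • (0, 1) := by simp
    rw [this, map_add, map_smul, map_smul, smul_eq_mul, smul_eq_mul, mul_comm x, mul_comm y]
  have hl (p : ℝ × ℝ) : Complex.exp (L (p.1 + a * p.2, p.1 - b * p.2) * Complex.I) =
      Complex.exp (((s + t : ℝ) : ℂ) * p.1 * Complex.I) *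
        Complex.exp (((s * a - t * b : ℝ) : ℂ) * p.2 * Complex.I) := by
    rw [← Complex.exp_add, hL]
    push_cast
    ring_nf
  have hr (p : ℝ × ℝ) : Complex.exp (L p * Complex.I) =
      Complex.exp (s * p.1 * Complex.I) * Complex.exp (t * p.2 * Complex.I) := by
    rw [← Complex.exp_add, hL p.1 p.2]
    push_cast
    ring_nf
  rw [charFunDual_apply, charFunDual_apply, integral_map hmeas.aemeasurable (by fun_prop)]
  simp_rw [hl, hr]
  rw [integral_prod_mul (μ := gauss m σ) (ν := gauss 0 1)
      (fun x => Complex.exp (((s + t : ℝ) : ℂ) * x * Complex.I))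
      (fun x => Complex.exp (((s * a - t * b : ℝ) : ℂ) * x * Complex.I)),
    integral_prod_mul (μ := gauss m σ₁) (ν := gauss m σ₂)
      (fun x => Complex.exp (s * x * Complex.I)) (fun x => Complex.exp (t * x * Complex.I)),
    ← charFun_apply_real, ← charFun_apply_real, ← charFun_apply_real, ← charFun_apply_real,
    charFun_gauss, charFun_gauss, charFun_gauss, charFun_gauss, ← Complex.exp_add,
    ← Complex.exp_add]
  congr 1
  have ha' : (σ₁ : ℂ) ^ 2 = (σ : ℂ) ^ 2 + (a : ℂ) ^ 2 := by exact_mod_cast ha.symm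
  have hb' : (σ₂ : ℂ) ^ 2 = (σ : ℂ) ^ 2 + (b : ℂ) ^ 2 := by exact_mod_cast hb.symm
  have hab' : (a : ℂ) * b = (σ : ℂ) ^ 2 := by exact_mod_cast hab
  push_cast
  rw [ha', hb']
  linear_combination (s * t : ℂ) * hab'

/-- The precision-weighted mean of the two observations. -/
lemma map_weightedMean {σ σ₁ σ₂ : ℝ} (h₁ : σ₁ ≠ 0) (h₂ : σ₂ ≠ 0)
    (h : σ ^ 2 * (σ₁ ^ 2 + σ₂ ^ 2) = σ₁ ^ 2 * σ₂ ^ 2) (m : ℝ) :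
    ((gauss m σ₁).prod (gauss m σ₂)).map
      (fun p => σ ^ 2 / σ₁ ^ 2 * p.1 + σ ^ 2 / σ₂ ^ 2 * p.2) = gauss m σ := by
  have hg (c τ : ℝ) : (gauss m τ).map (c * ·) =
      gaussianReal (c * m) ((c * τ) ^ 2).toNNReal := by
    rw [gauss, gaussianReal_map_const_mul]
    congr 1
    rw [mul_pow, Real.toNNReal_mul (sq_nonneg c)]
    congr 1
    ext
    simp [sq_nonneg]
  have : (fun p : ℝ × ℝ => σ ^ 2 / σ₁ ^ 2 * p.1 + σ ^ 2 / σ₂ ^ 2 * p.2) =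
      (fun p => p.1 + p.2) ∘ Prod.map (σ ^ 2 / σ₁ ^ 2 * ·) (σ ^ 2 / σ₂ ^ 2 * ·) := rfl
  rw [this, ← Measure.map_map (by fun_prop) (by fun_prop),
    ← Measure.map_prod_map _ _ (by fun_prop) (by fun_prop), hg, hg]
  change (gaussianReal _ _).conv (gaussianReal _ _) = _
  rw [gaussianReal_conv_gaussianReal, gauss, ← Real.toNNReal_add (sq_nonneg _) (sq_nonneg _)]
  have h₁₂ : σ₁ ^ 2 + σ₂ ^ 2 ≠ 0 := by positivity
  have hw : σ ^ 2 = σ₁ ^ 2 * σ₂ ^ 2 / (σ₁ ^ 2 + σ₂ ^ 2) := by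
    rw [← h, mul_div_cancel_right₀ _ h₁₂]
  congr 2
  · rw [hw]
    field_simp
    ring
  · rw [mul_pow, mul_pow, hw]
    field_simp
    ring

end Gaussian

/-! ### Measurability and clipping -/

section Clip

variable {ι : Type*} [Fintype ι]

lemma measurable_clip (C : ℝ) : Measurable (clip (ι := ι) C) := by
  unfold clip
  fun_prop

lemma norm_clip_le {C : ℝ} (hC : 0 < C) (x : EuclideanSpace ℝ ι) : ‖clip C x‖ ≤ C := by
  have h0 : 0 < max 1 (‖x‖ / C) := lt_max_of_lt_left one_pos
  rw [clip, norm_smul, norm_inv, Real.norm_of_nonneg h0.le, inv_mul_le_iff₀ h0, ← div_le_iff₀ hC]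
  exact le_max_right _ _

lemma clip_eq_self {C : ℝ} (hC : 0 < C) {x : EuclideanSpace ℝ ι} (hx : ‖x‖ ≤ C) :
    clip C x = x := by
  rw [clip, max_eq_left ((div_le_one hC).2 hx), inv_one, one_smul]

lemma norm_inv_smul_clip_le {C : ℝ} (hC : 0 < C) (x : EuclideanSpace ℝ ι) :
    ‖C⁻¹ • clip C x‖ ≤ 1 := by
  rw [norm_smul, norm_inv, Real.norm_of_nonneg hC.le, inv_mul_le_iff₀ hC, mul_one]
  exact norm_clip_le hC x

lemma measurable_sum_map {α X : Type*} [MeasurableSpace X] (B : Multiset α)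
    {f : α → X → EuclideanSpace ℝ ι} (hf : ∀ x, Measurable (f x)) :
    Measurable fun y => (B.map fun x => f x y).sum := by
  induction B using Multiset.induction_on with
  | empty => simp
  | cons a B ih =>
    simp only [Multiset.map_cons, Multiset.sum_cons]
    exact (hf a).add ih

lemma sum_map_replicate_add {α M : Type*} [AddCommMonoid M] (k : ℕ) (x : α) (B : Multiset α)
    (f : α → M) : ((Multiset.replicate k x + B).map f).sum = (B.map f).sum + k • f x := by
  simp [add_comm]

lemma measurable_snoc {Y : Type*} [MeasurableSpace Y] (T : ℕ) :
    Measurable fun p : (Fin T → Y) × Y => Fin.snoc (α := fun _ => Y) p.1 p.2 := by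
  refine measurable_pi_iff.2 fun j => ?_
  induction j using Fin.lastCases with
  | last => simpa using measurable_snd
  | cast j =>
    simp only [Fin.snoc_castSucc]
    fun_prop

end Clip

section Reorder

variable {X Y Z W : Type*} [MeasurableSpace X] [MeasurableSpace Y] [MeasurableSpace Z]
  [MeasurableSpace W]

lemma measurePreserving_prod_left_comm (μ : Measure X) (ν : Measure Y) (ρ : Measure Z)
    [SFinite μ] [SFinite ν] [SFinite ρ] :
    MeasurePreserving (fun p : X × Y × Z => (p.2.1, p.1, p.2.2)) (μ.prod (ν.prod ρ))
      (ν.prod (μ.prod ρ)) :=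
  (measurePreserving_prodAssoc ν μ ρ).comp
    ((Measure.measurePreserving_swap.prod (.id ρ)).comp (measurePreserving_prodAssoc μ ν ρ).symm)

lemma measurePreserving_prod_prod_comm (μ : Measure X) (ν : Measure Y) (ρ : Measure Z)
    (τ : Measure W) [SFinite μ] [SFinite ν] [SFinite ρ] [SFinite τ] :
    MeasurePreserving (fun p : (X × Y) × (Z × W) => ((p.1.1, p.2.1), (p.1.2, p.2.2)))
      ((μ.prod ν).prod (ρ.prod τ)) ((μ.prod ρ).prod (ν.prod τ)) :=
  (measurePreserving_prodAssoc μ ρ (ν.prod τ)).symm.comp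
    (((MeasurePreserving.id μ).prod (measurePreserving_prod_left_comm ν ρ τ)).comp
      (measurePreserving_prodAssoc μ ν (ρ.prod τ)))

end Reorder

/-! ### Poisson subsampling -/

section Subsampling

instance (γ : unitInterval) (n : ℕ) : IsProbabilityMeasure (inclusionLaw γ n) := by
  unfold inclusionLaw
  infer_instance

lemma bernoulliMeasure_eq (γ : unitInterval) : bernoulliMeasure true false γ =
    ENNReal.ofReal (1 - γ) • Measure.dirac false +
      ENNReal.ofReal γ • Measure.dirac true := by
  have h (p : unitInterval) : ENNReal.ofReal (p : ℝ) = (unitInterval.toNNReal p : ENNReal) := by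
    rw [ENNReal.ofReal]
    congr 1
    exact Real.toNNReal_of_nonneg p.2.1
  have h' := h (unitInterval.symm γ)
  rw [unitInterval.coe_symm_eq] at h'
  rw [bernoulliMeasure_def, h, h', add_comm]
  rfl

instance (γ : unitInterval) (σ : ℝ) : IsProbabilityMeasure (gaussMixture γ σ) := by
  refine ⟨?_⟩
  rw [gaussMixture]
  simp only [Measure.coe_add, Measure.coe_smul, Pi.add_apply, Pi.smul_apply, measure_univ,
    smul_eq_mul, mul_one]
  rw [← ENNReal.ofReal_add (by linarith [γ.2.2]) γ.2.1]
  simp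

lemma minibatch_insertNth {α : Type*} {n : ℕ} (D : Fin (n + 1) → α) (i : Fin (n + 1)) (b : Bool)
    (s : Fin n → Bool) : minibatch D (i.insertNth (α := fun _ => Bool) b s) =
      Multiset.replicate b.toNat (D i) + minibatch (i.removeNth D) s := by
  have h : (Finset.univ.filter fun j => i.insertNth (α := fun _ => Bool) b s j = true) =
      (if b then {i} else ∅) ∪
        (Finset.univ.filter fun j => s j = true).map i.succAboveEmb := by
    ext j
    obtain rfl | ⟨j, rfl⟩ := i.eq_self_or_eq_succAbove j <;> cases b <;> simp [Fin.succAbove_ne]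
  have hd : Disjoint (if b then {i} else ∅)
      ((Finset.univ.filter fun j => s j = true).map i.succAboveEmb) := by
    cases b <;> simp [Fin.succAbove_ne]
  rw [minibatch, h, ← Finset.disjUnion_eq_union _ _ hd, Finset.disjUnion_val, Multiset.map_add,
    Finset.map_val, Multiset.map_map]
  cases b <;> rfl

lemma map_insertNth_inclusionLaw (γ : unitInterval) {n : ℕ} (i : Fin (n + 1)) :
    ((inclusionLaw γ n).prod (bernoulliMeasure true false γ)).map
      (fun q => i.insertNth (α := fun _ => Bool) q.2 q.1) = inclusionLaw γ (n + 1) := by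
  have h := (measurePreserving_piFinSuccAbove
    (fun _ : Fin (n + 1) => bernoulliMeasure true false γ) i).symm.map_eq
  rw [inclusionLaw, inclusionLaw, ← h, ← Measure.prod_swap, Measure.map_map
    (measurable_of_countable _) measurable_swap]
  rfl

variable {α N W Y : Type*} [MeasurableSpace N] [MeasurableSpace W] [MeasurableSpace Y]

/-- A subsampled step in which the examples other than `x` follow a random choice `s`. Once these
are fixed, including `x` with probability `γ` mixes the laws with and without `x`. -/
lemma map_bernoulli_prod (γ : unitInterval) (σ : ℝ) {μ : Measure N} [SFinite μ] {ν : Measure W}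
    [SFinite ν] {r : ℕ → N → Y} {Φ : ℝ × W → Y} (hr : ∀ k, Measurable (r k))
    (hΦ : Measurable Φ) (h : ∀ k : ℕ, μ.map (r k) = ((gauss k σ).prod ν).map Φ) :
    ((bernoulliMeasure true false γ).prod μ).map (fun q => r q.1.toNat q.2) =
      ((gaussMixture γ σ).prod ν).map Φ := by
  have hm : Measurable fun q : Bool × N => r q.1.toNat q.2 :=
    measurable_from_prod_countable_right fun b => hr b.toNat
  have h0 := h 0
  have h1 := h 1
  rw [Nat.cast_zero] at h0
  rw [Nat.cast_one] at h1
  rw [bernoulliMeasure_eq, gaussMixture, Measure.add_prod, Measure.add_prod,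
    Measure.map_add _ _ hm, Measure.map_add _ _ hΦ, Measure.prod_smul_left,
    Measure.prod_smul_left, Measure.prod_smul_left, Measure.prod_smul_left, Measure.map_smul,
    Measure.map_smul, Measure.map_smul, Measure.map_smul, Measure.dirac_prod, Measure.dirac_prod,
    Measure.map_map hm (by fun_prop), Measure.map_map hm (by fun_prop), ← h0, ← h1]
  rfl

/-- Law of a subsampled release on the larger dataset, in terms of the mixture. -/
lemma map_subsample_of_mem (γ : unitInterval) (σ : ℝ) {n : ℕ} (D : Fin (n + 1) → α)
    (i : Fin (n + 1)) {μ : Measure N} [SFinite μ] {ν : Measure W} [SFinite ν]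
    {r : Multiset α → N → Y} {Φ : Multiset α → ℝ × W → Y} (hr : ∀ B, Measurable (r B))
    (hΦ : ∀ B, Measurable (Φ B))
    (h : ∀ (k : ℕ) B, μ.map (r (Multiset.replicate k (D i) + B)) =
      ((gauss k σ).prod ν).map (Φ B)) :
    ((inclusionLaw γ (n + 1)).prod μ).map (fun q => r (minibatch D q.1) q.2) =
      ((gaussMixture γ σ).prod ((inclusionLaw γ n).prod ν)).map
        (fun q => Φ (minibatch (i.removeNth D) q.2.1) (q.1, q.2.2)) := by
  have hm : Measurable fun q : (Fin (n + 1) → Bool) × N => r (minibatch D q.1) q.2 :=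
    measurable_from_prod_countable_right fun s => hr (minibatch D s)
  have hm' : Measurable fun q : (Fin n → Bool) × (Bool × N) =>
      r (Multiset.replicate q.2.1.toNat (D i) + minibatch (i.removeNth D) q.1) q.2.2 :=
    measurable_from_prod_countable_right fun s =>
      measurable_from_prod_countable_right fun b =>
        hr (Multiset.replicate b.toNat (D i) + minibatch (i.removeNth D) s)
  have hmΦ : Measurable fun q : (Fin n → Bool) × (ℝ × W) =>
      Φ (minibatch (i.removeNth D) q.1) q.2 :=
    measurable_from_prod_countable_right fun s => hΦ (minibatch (i.removeNth D) s)
  have hins : Measurable fun q : (Fin n → Bool) × Bool =>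
      i.insertNth (α := fun _ => Bool) q.2 q.1 := measurable_of_countable _
  calc _ = ((((inclusionLaw γ n).prod (bernoulliMeasure true false γ)).prod μ).map
        (Prod.map (fun q => i.insertNth (α := fun _ => Bool) q.2 q.1) id)).map
          (fun q => r (minibatch D q.1) q.2) := by
        rw [← Measure.map_prod_map _ _ hins measurable_id, map_insertNth_inclusionLaw,
          Measure.map_id]
    _ = ((inclusionLaw γ n).prod ((bernoulliMeasure true false γ).prod μ)).map
        (fun q => r (Multiset.replicate q.2.1.toNat (D i) + minibatch (i.removeNth D) q.1)
          q.2.2) := by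
        rw [← Measure.prodAssoc_prod, Measure.map_map hm (by fun_prop),
          Measure.map_map hm' (MeasurableEquiv.measurable _)]
        congr 1
        funext q
        simp only [Function.comp_apply, Prod.map_fst, Prod.map_snd, id, minibatch_insertNth]
        rfl
    _ = ((inclusionLaw γ n).prod ((gaussMixture γ σ).prod ν)).map
        (fun q => Φ (minibatch (i.removeNth D) q.1) q.2) :=
        map_prod_congr _ _ _ hm' hmΦ fun s => map_bernoulli_prod γ σ
          (r := fun k => r (Multiset.replicate k (D i) + minibatch (i.removeNth D) s))
          (fun k => hr _) (hΦ (minibatch (i.removeNth D) s)) fun k => h k _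
    _ = _ := by
        rw [← (measurePreserving_prod_left_comm (gaussMixture γ σ) (inclusionLaw γ n) ν).map_eq,
          Measure.map_map hmΦ (by fun_prop)]
        rfl

/-- Law of a subsampled release on the smaller dataset. -/
lemma map_subsample_of_notMem (γ : unitInterval) (σ : ℝ) {n : ℕ} (D : Fin n → α)
    {μ : Measure N} [SFinite μ] {ν : Measure W} [SFinite ν]
    {r : Multiset α → N → Y} {Φ : Multiset α → ℝ × W → Y} (hr : ∀ B, Measurable (r B))
    (hΦ : ∀ B, Measurable (Φ B)) (h : ∀ B, μ.map (r B) = ((gauss 0 σ).prod ν).map (Φ B)) :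
    ((inclusionLaw γ n).prod μ).map (fun q => r (minibatch D q.1) q.2) =
      ((gauss 0 σ).prod ((inclusionLaw γ n).prod ν)).map
        (fun q => Φ (minibatch D q.2.1) (q.1, q.2.2)) := by
  have hmΦ : Measurable fun q : (Fin n → Bool) × (ℝ × W) => Φ (minibatch D q.1) q.2 :=
    measurable_from_prod_countable_right fun s => hΦ (minibatch D s)
  rw [map_prod_congr (inclusionLaw γ n) μ ((gauss 0 σ).prod ν)
    (g := fun q => Φ (minibatch D q.1) q.2) 
    (measurable_from_prod_countable_right fun s => hr (minibatch D s)) hmΦ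
    fun s => h (minibatch D s),
    ← (measurePreserving_prod_left_comm (gauss 0 σ) (inclusionLaw γ n) ν).map_eq,
    Measure.map_map hmΦ (by fun_prop)]
  rfl

end Subsampling

/-! ### One step as an image of one-dimensional normal laws -/

section Shift

variable {E Y : Type*} [NormedAddCommGroup E] [InnerProductSpace ℝ E] [FiniteDimensional ℝ E]
  [MeasurableSpace E] [BorelSpace E] [MeasurableSpace Y]

lemma map_comp_spread (m σ : ℝ) {u : E} (hu : ‖u‖ ≤ 1) {F : E → Y} (hF : Measurable F) :
    ((gauss m σ).prod (stdGaussian E)).map (fun p => F (spread σ u p)) =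
      (stdGaussian E).map fun w => F (m • u + σ • w) := by
  have h : Measurable (spread σ u) := measurable_spread σ measurable_const measurable_id
  have := congrArg (Measure.map F) (map_spread m σ hu)
  rwa [Measure.map_map hF h, Measure.map_map hF (by fun_prop)] at this

lemma measurable_add_smul {X : Type*} [MeasurableSpace X] {f g : X → E} (hf : Measurable f)
    (hg : Measurable g) (a : ℝ) : Measurable fun x => f x + a • g x := by
  fun_prop

end Shift

section MaskRows

variable {c d : ℕ}

lemma measurable_contributionMap : Measurable (contributionMap : Table c d → BucketVec c) := by
  refine (PiLp.continuous_toLp 2 _).measurable.comp (measurable_pi_iff.2 fun j => ?_)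
  refine Measurable.ite ?_ measurable_const measurable_const
  have : {g : Table c d | ∃ k, g (j, k) ≠ 0} = ⋃ k, {g | g (j, k) ≠ 0} := by
    ext
    simp
  rw [this]
  refine .iUnion fun k => MeasurableSet.compl ?_
  exact measurableSet_eq_fun (by fun_prop) measurable_const

lemma measurable_maskRows {X : Type*} [MeasurableSpace X] (τ : ℝ) {V : X → BucketVec c}
    {g : X → Table c d} (hV : Measurable V) (hg : Measurable g) :
    Measurable fun x => maskRows τ (V x) (g x) := by
  refine (PiLp.continuous_toLp 2 _).measurable.comp (measurable_pi_iff.2 fun j => ?_)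
  exact Measurable.ite (measurableSet_lt (by fun_prop) measurable_const) measurable_const
    (by fun_prop)

lemma maskRows_add (τ : ℝ) (V : BucketVec c) (g h : Table c d) :
    maskRows τ V (g + h) = maskRows τ V g + maskRows τ V h := by
  ext p
  by_cases hp : V p.1 < τ <;> simp [maskRows, hp]

lemma maskRows_smul (τ : ℝ) (V : BucketVec c) (a : ℝ) (g : Table c d) :
    maskRows τ V (a • g) = a • maskRows τ V g := by
  ext p
  by_cases hp : V p.1 < τ <;> simp [maskRows, hp]

lemma maskRows_maskRows (τ : ℝ) (V : BucketVec c) (g : Table c d) :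
    maskRows τ V (maskRows τ V g) = maskRows τ V g := by
  ext p
  by_cases hp : V p.1 < τ <;> simp [maskRows, hp]

end MaskRows

namespace AdaFEST

variable {α : Type*} {c d : ℕ}

/-- The noisy contribution map of `B` at `θ`, with a scalar carrying the contribution of one
more example `x`: a scalar drawn from `N(k, σ₁²)` simulates the batch with `k` extra copies of
`x`. The argument `p` is the scalar together with independent standard normal noise. -/
noncomputable def mapSim (A : AdaFEST α c d) (B : Multiset α) (x : α) (θ : Table c d)
    (p : ℝ × BucketVec c) : BucketVec c :=
  (B.map fun y => clip A.C₁ (contributionMap (A.grad y θ))).sum +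
    A.C₁ • spread A.σ₁ (A.C₁⁻¹ • clip A.C₁ (contributionMap (A.grad x θ))) p

/-- The masked noisy gradient of `B`, with a scalar carrying the contribution of one more example
`x`, as in `mapSim`. -/
noncomputable def gradSim (A : AdaFEST α c d) (B : Multiset α) (x : α) (θ : Table c d)
    (V : BucketVec c) (p : ℝ × Table c d) : Table c d :=
  (B.map fun y => clip A.C₂ (maskRows A.τ V (A.grad y θ))).sum +
    A.C₂ • maskRows A.τ V
      (spread A.σ₂ (A.C₂⁻¹ • clip A.C₂ (maskRows A.τ V (A.grad x θ))) p)

section Measurability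

variable {X : Type*} [MeasurableSpace X] {θ : X → Table c d} {V : X → BucketVec c}

lemma measurable_clip_contributionMap (A : AdaFEST α c d) (hgrad : ∀ x, Measurable (A.grad x))
    (hθ : Measurable θ) (y : α) :
    Measurable fun q => clip A.C₁ (contributionMap (A.grad y (θ q))) :=
  (measurable_clip _).comp (measurable_contributionMap.comp ((hgrad y).comp hθ))

lemma measurable_clip_maskRows (A : AdaFEST α c d) (hgrad : ∀ x, Measurable (A.grad x))
    (hθ : Measurable θ) (hV : Measurable V) (y : α) :
    Measurable fun q => clip A.C₂ (maskRows A.τ (V q) (A.grad y (θ q))) :=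
  (measurable_clip _).comp (measurable_maskRows A.τ hV ((hgrad y).comp hθ))

lemma measurable_noisyMap (A : AdaFEST α c d) (hgrad : ∀ x, Measurable (A.grad x))
    (B : Multiset α) {z : X → BucketVec c} (hθ : Measurable θ) (hz : Measurable z) :
    Measurable fun q => A.noisyMap B (θ q) (z q) :=
  measurable_add_smul (measurable_sum_map B (A.measurable_clip_contributionMap hgrad hθ))
    (hz.const_smul A.σ₁) A.C₁

lemma measurable_mapSim (A : AdaFEST α c d) (hgrad : ∀ x, Measurable (A.grad x))
    (B : Multiset α) (x : α) {p : X → ℝ × BucketVec c} (hθ : Measurable θ) (hp : Measurable p) :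
    Measurable fun q => A.mapSim B x (θ q) (p q) :=
  measurable_add_smul (measurable_sum_map B (A.measurable_clip_contributionMap hgrad hθ))
    (measurable_spread A.σ₁
      ((A.measurable_clip_contributionMap hgrad hθ x).const_smul A.C₁⁻¹) hp) A.C₁

lemma measurable_noisyGrad (A : AdaFEST α c d) (hgrad : ∀ x, Measurable (A.grad x))
    (B : Multiset α) {z : X → Table c d} (hθ : Measurable θ) (hV : Measurable V)
    (hz : Measurable z) : Measurable fun q => A.noisyGrad B (θ q) (V q) (z q) :=
  measurable_add_smul (measurable_sum_map B (A.measurable_clip_maskRows hgrad hθ hV))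
    ((measurable_maskRows A.τ hV hz).const_smul A.σ₂) A.C₂

lemma measurable_gradSim (A : AdaFEST α c d) (hgrad : ∀ x, Measurable (A.grad x))
    (B : Multiset α) (x : α) {p : X → ℝ × Table c d} (hθ : Measurable θ) (hV : Measurable V)
    (hp : Measurable p) : Measurable fun q => A.gradSim B x (θ q) (V q) (p q) :=
  measurable_add_smul (measurable_sum_map B (A.measurable_clip_maskRows hgrad hθ hV))
    (measurable_maskRows A.τ hV (measurable_spread A.σ₂
      ((A.measurable_clip_maskRows hgrad hθ hV x).const_smul A.C₂⁻¹) hp)) A.C₂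

end Measurability

lemma map_mapSim (A : AdaFEST α c d) (hC₁ : 0 < A.C₁) (B : Multiset α) (x : α) (θ : Table c d)
    (k : ℕ) : ((gauss k A.σ₁).prod (stdGaussian (BucketVec c))).map
      (A.mapSim B x θ) = A.mapLaw (Multiset.replicate k x + B) θ := by
  rw [mapLaw]
  unfold mapSim
  rw [map_comp_spread k A.σ₁ (norm_inv_smul_clip_le hC₁ (contributionMap (A.grad x θ)))
    (F := fun v => (B.map fun y => clip A.C₁ (contributionMap (A.grad y θ))).sum + A.C₁ • v)
    (by fun_prop)]
  congr 1
  funext w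
  rw [noisyMap, sum_map_replicate_add, smul_add, ← add_assoc, smul_comm A.C₁,
    smul_inv_smul₀ hC₁.ne', Nat.cast_smul_eq_nsmul]

lemma map_gradSim (A : AdaFEST α c d) (hC₂ : 0 < A.C₂) (B : Multiset α) (x : α) (θ : Table c d)
    (V : BucketVec c) (k : ℕ) : ((gauss k A.σ₂).prod (stdGaussian (Table c d))).map
      (A.gradSim B x θ V) = A.gradLaw (Multiset.replicate k x + B) θ V := by
  rw [gradLaw]
  unfold gradSim
  have hmask : Measurable (maskRows (d := d) A.τ V) :=
    measurable_maskRows A.τ measurable_const measurable_id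
  rw [map_comp_spread k A.σ₂ (norm_inv_smul_clip_le hC₂ (maskRows A.τ V (A.grad x θ)))
    (F := fun v => (B.map fun y => clip A.C₂ (maskRows A.τ V (A.grad y θ))).sum +
      A.C₂ • maskRows A.τ V v) (measurable_add_smul measurable_const hmask A.C₂)]
  congr 1
  funext w
  -- the clipped gradient is already masked, so masking leaves the mean of the noise unchanged
  rw [noisyGrad, sum_map_replicate_add, maskRows_add, maskRows_smul, maskRows_smul, maskRows_smul,
    smul_add, ← add_assoc, smul_comm A.C₂ (k : ℝ), smul_inv_smul₀ hC₂.ne',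
    Nat.cast_smul_eq_nsmul, clip, maskRows_smul, maskRows_maskRows]

/-- Both releases of one step with the batch `B`, with one scalar carrying the contribution of one
more example `x`. The argument `p` is the scalar together with noise, whose first coordinate splits
the scalar into one scalar for each of the two releases, with the coefficients `a`, `b` of
`map_split`. -/
noncomputable def stepSim (A : AdaFEST α c d) (a b : ℝ) (B : Multiset α) (x : α) (θ : Table c d)
    (p : ℝ × (ℝ × BucketVec c × Table c d)) : BucketVec c × Table c d :=
  (A.mapSim B x θ (p.1 + a * p.2.1, p.2.2.1),
    A.gradSim B x θ (A.mapSim B x θ (p.1 + a * p.2.1, p.2.2.1)) (p.1 - b * p.2.1, p.2.2.2))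

/-- The law of the noise consumed by `stepSim`. -/
noncomputable abbrev simNoise (c d : ℕ) : Measure (ℝ × BucketVec c × Table c d) :=
  (gauss 0 1).prod ((stdGaussian (BucketVec c)).prod (stdGaussian (Table c d)))

lemma measurable_stepSim {X : Type*} [MeasurableSpace X] (A : AdaFEST α c d)
    (hgrad : ∀ x, Measurable (A.grad x)) (a b : ℝ) (B : Multiset α) (x : α) {θ : X → Table c d}
    {p : X → ℝ × (ℝ × BucketVec c × Table c d)} (hθ : Measurable θ) (hp : Measurable p) :
    Measurable fun q => A.stepSim a b B x (θ q) (p q) :=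
  have h := A.measurable_mapSim hgrad B x
    (p := fun q => ((p q).1 + a * (p q).2.1, (p q).2.2.1)) hθ (by fun_prop)
  h.prodMk (A.measurable_gradSim hgrad B x hθ h (by fun_prop))

lemma measurable_step {X : Type*} [MeasurableSpace X] (A : AdaFEST α c d)
    (hgrad : ∀ x, Measurable (A.grad x)) (B : Multiset α) {θ z₂ : X → Table c d}
    {z₁ : X → BucketVec c} (hθ : Measurable θ) (h₁ : Measurable z₁) (h₂ : Measurable z₂) :
    Measurable fun q => A.step B (θ q) (z₁ q) (z₂ q) :=
  have h := A.measurable_noisyMap hgrad B hθ h₁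
  h.prodMk (A.measurable_noisyGrad hgrad B hθ h h₂)

/-- The two scalars are independent after the split. The first one produces the noisy map, and
for every value `V` of the map the second one produces the gradient masked by `V`. -/
lemma map_stepSim (A : AdaFEST α c d) (hgrad : ∀ x, Measurable (A.grad x)) (hC₁ : 0 < A.C₁)
    (hC₂ : 0 < A.C₂) {σ a b : ℝ} (ha : σ ^ 2 + a ^ 2 = A.σ₁ ^ 2) (hb : σ ^ 2 + b ^ 2 = A.σ₂ ^ 2)
    (hab : a * b = σ ^ 2) (B : Multiset α) (x : α) (θ : Table c d) (k : ℕ) :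
    ((gauss k σ).prod (simNoise c d)).map (A.stepSim a b B x θ) =
      A.stepLaw (Multiset.replicate k x + B) θ := by
  set B' := Multiset.replicate k x + B with hB'
  have hmap : Measurable (A.mapSim B x θ) :=
    A.measurable_mapSim hgrad B x measurable_const measurable_id
  have hnoisy : Measurable (A.noisyMap B' θ) :=
    A.measurable_noisyMap hgrad B' measurable_const measurable_id
  have hgradSim : Measurable fun q : BucketVec c × (ℝ × Table c d) =>
      (q.1, A.gradSim B x θ q.1 q.2) :=
    measurable_fst.prodMk (A.measurable_gradSim hgrad B x measurable_const measurable_fst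
      measurable_snd)
  have hgradNoisy : Measurable fun q : BucketVec c × Table c d =>
      (q.1, A.noisyGrad B' θ q.1 q.2) :=
    measurable_fst.prodMk (A.measurable_noisyGrad hgrad B' measurable_const measurable_fst
      measurable_snd)
  have hsplit : Measurable fun p : ℝ × ℝ => (p.1 + a * p.2, p.1 - b * p.2) := by fun_prop
  have hsim : Measurable fun p : (ℝ × BucketVec c) × (ℝ × Table c d) =>
      (A.mapSim B x θ p.1, A.gradSim B x θ (A.mapSim B x θ p.1) p.2) :=
    hgradSim.comp ((hmap.comp measurable_fst).prodMk measurable_snd)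
  have hstep : Measurable (A.stepSim a b B x θ) :=
    A.measurable_stepSim hgrad a b B x measurable_const measurable_id
  have hcomm := measurePreserving_prod_prod_comm (gauss k A.σ₁) (gauss k A.σ₂)
    (stdGaussian (BucketVec c)) (stdGaussian (Table c d))
  calc _ = (((((gauss k σ).prod (gauss 0 1)).prod ((stdGaussian (BucketVec c)).prod
        (stdGaussian (Table c d)))).map (Prod.map (fun p => (p.1 + a * p.2, p.1 - b * p.2))
          id)).map (fun p => ((p.1.1, p.2.1), (p.1.2, p.2.2)))).map
          (fun p => (A.mapSim B x θ p.1, A.gradSim B x θ (A.mapSim B x θ p.1) p.2)) := by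
        rw [simNoise, ← Measure.prodAssoc_prod, Measure.map_map hstep
          (MeasurableEquiv.measurable _), Measure.map_map hsim hcomm.measurable,
          Measure.map_map (hsim.comp hcomm.measurable) (hsplit.prodMap measurable_id)]
        rfl
    _ = (((gauss k A.σ₁).prod (stdGaussian (BucketVec c))).prod
          ((gauss k A.σ₂).prod (stdGaussian (Table c d)))).map
          (fun p => (A.mapSim B x θ p.1, A.gradSim B x θ (A.mapSim B x θ p.1) p.2)) := by
        rw [← Measure.map_prod_map _ _ hsplit measurable_id, map_split ha hb hab, Measure.map_id,
          hcomm.map_eq]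
    _ = ((A.mapLaw B' θ).prod ((gauss k A.σ₂).prod (stdGaussian (Table c d)))).map
          (fun q => (q.1, A.gradSim B x θ q.1 q.2)) := by
        rw [hB', ← A.map_mapSim hC₁ B x θ k]
        conv_rhs => rw [← Measure.map_id (μ := (gauss k A.σ₂).prod (stdGaussian (Table c d)))]
        rw [Measure.map_prod_map _ _ hmap measurable_id,
          Measure.map_map hgradSim (hmap.prodMap measurable_id)]
        rfl
    _ = ((A.mapLaw B' θ).prod (stdGaussian (Table c d))).map
          (fun q => (q.1, A.noisyGrad B' θ q.1 q.2)) := by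
        have : SFinite (A.mapLaw B' θ) := by unfold mapLaw; infer_instance
        refine map_prod_congr _ _ _ hgradSim hgradNoisy fun V => ?_
        have h₁ : Measurable (A.gradSim B x θ V) :=
          A.measurable_gradSim hgrad B x measurable_const measurable_const measurable_id
        have h₂ : Measurable (A.noisyGrad B' θ V) :=
          A.measurable_noisyGrad hgrad B' measurable_const measurable_const measurable_id
        have h := congrArg (Measure.map (Prod.mk V)) (A.map_gradSim hC₂ B x θ V k)
        rwa [gradLaw, ← hB', Measure.map_map (by fun_prop) h₁,
          Measure.map_map (by fun_prop) h₂] at h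
    _ = _ := by
        rw [stepLaw, mapLaw]
        conv_lhs => rw [← Measure.map_id (μ := stdGaussian (Table c d))]
        rw [Measure.map_prod_map _ _ hnoisy measurable_id,
          Measure.map_map hgradNoisy (hnoisy.prodMap measurable_id)]
        rfl

end AdaFEST

/-! ### Training transcripts as images of products of one-dimensional laws -/

lemma IsPostProcessing.const {Ω Ω' : Type*} [MeasurableSpace Ω] [MeasurableSpace Ω']
    (ν : Measure Ω') [IsProbabilityMeasure ν] (P Q : Measure Ω) [IsProbabilityMeasure P]
    [IsProbabilityMeasure Q] : IsPostProcessing ν ν P Q :=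
  ⟨Kernel.const Ω ν, inferInstance, by simp, by simp⟩

section Measurability

variable {X Y Z : Type*} [MeasurableSpace X] [MeasurableSpace Y] [MeasurableSpace Z]

lemma measurable_comp_discrete {S : Type*} [MeasurableSpace S] [Countable S]
    [MeasurableSingletonClass S] {s : X → S} (hs : Measurable s) {f : S → X → Y}
    (hf : ∀ s, Measurable (f s)) : Measurable fun x => f (s x) x :=
  (measurable_from_prod_countable_right (f := fun q : S × X => f q.1 q.2) hf).comp
    (hs.prodMk measurable_id)

/-- Append the release of a new step to a transcript. -/
def append {T : ℕ} (h : X × (Fin T → Y)) (y : Y) : X × (Fin (T + 1) → Y) :=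
  (h.1, Fin.snoc (α := fun _ => Y) h.2 y)

lemma measurable_append {T : ℕ} {h : Z → X × (Fin T → Y)} {y : Z → Y} (hh : Measurable h)
    (hy : Measurable y) : Measurable fun z => append (h z) (y z) :=
  hh.fst.prodMk ((measurable_snoc T).comp (hh.snd.prodMk hy))

/-- The inductive step for the transcript of a subsampled training algorithm. Here `r B h` is the
release from the batch `B` after the transcript `h`; by assumption it can be simulated with `k`
extra copies of the example `D i` from a scalar drawn from `N(k, σ²)`. Sampling `D i` with
probability `γ` turns that scalar into one drawn from the mixture. -/
lemma IsPostProcessing.subsampled_step {α N W : Type*} [MeasurableSpace N] [MeasurableSpace W]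
    (γ : unitInterval) (σ : ℝ) {T n : ℕ} (D : Fin (n + 1) → α) (i : Fin (n + 1))
    {ρ ρ' : Measure (X × (Fin T → Y))} [SFinite ρ] [SFinite ρ']
    (hρ : IsPostProcessing ρ ρ' (prodPow (gaussMixture γ σ) T) (prodPow (gauss 0 σ) T))
    {μ : Measure N} [SFinite μ] {ν : Measure W} [IsProbabilityMeasure ν]
    {r : Multiset α → X × (Fin T → Y) → N → Y} {Φ : Multiset α → X × (Fin T → Y) → ℝ × W → Y}
    (hr : ∀ B, Measurable fun q : (X × (Fin T → Y)) × N => r B q.1 q.2)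
    (hΦ : ∀ B, Measurable fun q : (X × (Fin T → Y)) × (ℝ × W) => Φ B q.1 q.2)
    (hlaw : ∀ h (k : ℕ) B, μ.map (r (Multiset.replicate k (D i) + B) h) =
      ((gauss k σ).prod ν).map (Φ B h)) :
    IsPostProcessing
      ((ρ.prod ((inclusionLaw γ (n + 1)).prod μ)).map
        fun p => append p.1 (r (minibatch D p.2.1) p.1 p.2.2))
      ((ρ'.prod ((inclusionLaw γ n).prod μ)).map
        fun p => append p.1 (r (minibatch (i.removeNth D) p.2.1) p.1 p.2.2))
      (prodPow (gaussMixture γ σ) (T + 1)) (prodPow (gauss 0 σ) (T + 1)) := by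
  have hr' (h) (B) : Measurable fun z => append h (r B h z) :=
    measurable_append measurable_const ((hr B).comp measurable_prodMk_left)
  have hΦ' (h) (B) : Measurable fun p => append h (Φ B h p) :=
    measurable_append measurable_const ((hΦ B).comp measurable_prodMk_left)
  have hlaw' (h) (k : ℕ) (B) : μ.map (fun z => append h (r (Multiset.replicate k (D i) + B) h z)) =
      ((gauss k σ).prod ν).map (fun p => append h (Φ B h p)) := by
    have e := congrArg (Measure.map (append h)) (hlaw h k B)
    have happ : Measurable (append h : Y → X × (Fin (T + 1) → Y)) :=
      measurable_append measurable_const measurable_id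
    have h₁ : Measurable (r (Multiset.replicate k (D i) + B) h) :=
      (hr _).comp measurable_prodMk_left
    have h₂ : Measurable (Φ B h) := (hΦ B).comp measurable_prodMk_left
    rwa [Measure.map_map happ h₁, Measure.map_map happ h₂] at e
  have hext {m : ℕ} (D : Fin m → α) :
      Measurable fun p : (X × (Fin T → Y)) × ((Fin m → Bool) × N) =>
        append p.1 (r (minibatch D p.2.1) p.1 p.2.2) :=
    measurable_append measurable_fst (measurable_comp_discrete measurable_snd.fst fun s =>
      (hr (minibatch D s)).comp (measurable_fst.prodMk measurable_snd.snd))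
  have hsim : Measurable fun p : (X × (Fin T → Y)) × (ℝ × ((Fin n → Bool) × W)) =>
      append p.1 (Φ (minibatch (i.removeNth D) p.2.2.1) p.1 (p.2.1, p.2.2.2)) :=
    measurable_append measurable_fst (measurable_comp_discrete
      (f := fun s p => Φ (minibatch (i.removeNth D) s) p.1 (p.2.1, p.2.2.2))
      measurable_snd.snd.fst fun s => (hΦ (minibatch (i.removeNth D) s)).comp
        (measurable_fst.prodMk (measurable_snd.fst.prodMk measurable_snd.snd.snd)))
  refine (hρ.adaptive (gaussMixture γ σ) (gauss 0 σ) ((inclusionLaw γ n).prod ν) (hext D)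
    (hext (i.removeNth D)) hsim (fun h => ?_) fun h => ?_).trans (.prodPow_succ _ _ T)
  · exact map_subsample_of_mem γ σ D i (r := fun B z => append h (r B h z))
      (Φ := fun B p => append h (Φ B h p)) (hr' h) (hΦ' h) (hlaw' h)
  · exact map_subsample_of_notMem γ σ (i.removeNth D) (r := fun B z => append h (r B h z))
      (Φ := fun B p => append h (Φ B h p)) (hr' h) (hΦ' h) fun B => by simpa using hlaw' h 0 B

end Measurability

namespace AdaFEST

variable {α : Type*} {c d : ℕ}

lemma measurable_params (A : AdaFEST α c d) (T : ℕ) :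
    Measurable (A.params : Transcript c d T → Table c d) := by
  unfold params
  fun_prop

lemma measurable_extend {X : Type*} [MeasurableSpace X] (A : AdaFEST α c d)
    (hgrad : ∀ x, Measurable (A.grad x)) {T : ℕ} (B : Multiset α)
    {z₁ : X → BucketVec c} {z₂ : X → Table c d} {h : X → Transcript c d T}
    (h₁ : Measurable z₁) (h₂ : Measurable z₂) (hh : Measurable h) :
    Measurable fun q => A.extend B (z₁ q) (z₂ q) (h q) :=
  measurable_append hh (A.measurable_step hgrad B ((A.measurable_params T).comp hh) h₁ h₂)

lemma measurable_extend_minibatch (A : AdaFEST α c d) (hgrad : ∀ x, Measurable (A.grad x))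
    (T : ℕ) {n : ℕ} (D : Fin n → α) :
    Measurable fun p : Transcript c d T × ((Fin n → Bool) × BucketVec c × Table c d) =>
      A.extend (minibatch D p.2.1) p.2.2.1 p.2.2.2 p.1 :=
  measurable_comp_discrete measurable_snd.fst fun s =>
    A.measurable_extend hgrad (minibatch D s) measurable_snd.snd.fst measurable_snd.snd.snd
      measurable_fst

lemma isProbabilityMeasure_transcriptLaw (A : AdaFEST α c d) (hgrad : ∀ x, Measurable (A.grad x))
    (γ : unitInterval) (μ₀ : Measure (Table c d)) [IsProbabilityMeasure μ₀] {n : ℕ}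
    (D : Fin n → α) : ∀ T, IsProbabilityMeasure (A.transcriptLaw γ μ₀ D T)
  | 0 => Measure.isProbabilityMeasure_map (by fun_prop)
  | T + 1 => by
    have := A.isProbabilityMeasure_transcriptLaw hgrad γ μ₀ D T
    exact Measure.isProbabilityMeasure_map
      (A.measurable_extend_minibatch hgrad T D).aemeasurable

lemma isPostProcessing_mapLaw (A : AdaFEST α c d) (hgrad : ∀ x, Measurable (A.grad x))
    (hC₁ : 0 < A.C₁) (B : Multiset α) (x : α) (θ : Table c d) :
    IsPostProcessing (A.mapLaw (x ::ₘ B) θ) (A.mapLaw B θ) (gauss 1 A.σ₁) (gauss 0 A.σ₁) := by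
  have h := fun k => A.map_mapSim hC₁ B x θ k
  have h0 := h 0
  have h1 := h 1
  simp only [Nat.cast_zero, Nat.cast_one, Multiset.replicate_zero, zero_add,
    Multiset.replicate_one, Multiset.singleton_add] at h0 h1
  rw [← h0, ← h1]
  exact (IsPostProcessing.prod_noise _ _ _).map
    (A.measurable_mapSim hgrad B x measurable_const measurable_id)

lemma isPostProcessing_gradLaw (A : AdaFEST α c d) (hgrad : ∀ x, Measurable (A.grad x))
    (hC₂ : 0 < A.C₂) (B : Multiset α) (x : α) (θ : Table c d) (V : BucketVec c) :
    IsPostProcessing (A.gradLaw (x ::ₘ B) θ V) (A.gradLaw B θ V) (gauss 1 A.σ₂)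
      (gauss 0 A.σ₂) := by
  have h := fun k => A.map_gradSim hC₂ B x θ V k
  have h0 := h 0
  have h1 := h 1
  simp only [Nat.cast_zero, Nat.cast_one, Multiset.replicate_zero, zero_add,
    Multiset.replicate_one, Multiset.singleton_add] at h0 h1
  rw [← h0, ← h1]
  exact (IsPostProcessing.prod_noise _ _ _).map
    (A.measurable_gradSim hgrad B x measurable_const measurable_const measurable_id)

/-- The noise level of the sufficient statistic of two observations, and the coefficients `a`, `b`
of the extra noise that recovers the two observations from it. -/
lemma exists_split {σ₁ σ₂ σ : ℝ} (hσ₁ : 0 < σ₁) (hσ₂ : 0 < σ₂)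
    (hσ : σ = (σ₁ ^ (-2 : ℝ) + σ₂ ^ (-2 : ℝ)) ^ (-1 / 2 : ℝ)) :
    σ ^ 2 * (σ₁ ^ 2 + σ₂ ^ 2) = σ₁ ^ 2 * σ₂ ^ 2 ∧
      ∃ a b : ℝ, σ ^ 2 + a ^ 2 = σ₁ ^ 2 ∧ σ ^ 2 + b ^ 2 = σ₂ ^ 2 ∧ a * b = σ ^ 2 := by
  have hpos : 0 < σ₁ ^ (-2 : ℝ) + σ₂ ^ (-2 : ℝ) := by positivity
  have h2 (x : ℝ) (hx : 0 < x) : x ^ (-2 : ℝ) = (x ^ 2)⁻¹ := by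
    rw [Real.rpow_neg hx.le, Real.rpow_two]
  have hsq : σ ^ 2 = σ₁ ^ 2 * σ₂ ^ 2 / (σ₁ ^ 2 + σ₂ ^ 2) := by
    have hexp : (-1 / 2 : ℝ) * (2 : ℕ) = -1 := by norm_num
    rw [hσ, ← Real.rpow_natCast, ← Real.rpow_mul hpos.le, hexp, Real.rpow_neg_one, h2 _ hσ₁,
      h2 _ hσ₂]
    field_simp
    ring
  set s := σ₁ ^ 2 + σ₂ ^ 2 with hs
  have hs0 : 0 < s := by positivity
  have hss : √s ^ 2 = s := Real.sq_sqrt hs0.le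
  have hs' : √s ≠ 0 := (Real.sqrt_pos.2 hs0).ne'
  refine ⟨by rw [hsq, div_mul_cancel₀ _ hs0.ne'],
    σ₁ ^ 2 / √s, σ₂ ^ 2 / √s, ?_, ?_, ?_⟩
  · rw [hsq, div_pow, hss]
    field_simp
    linarith
  · rw [hsq, div_pow, hss]
    field_simp
    linarith
  · rw [hsq, div_mul_div_comm, ← sq √s, hss]

lemma isPostProcessing_stepLaw (A : AdaFEST α c d) (hgrad : ∀ x, Measurable (A.grad x))
    (hC₁ : 0 < A.C₁) (hC₂ : 0 < A.C₂) {σ a b : ℝ} (ha : σ ^ 2 + a ^ 2 = A.σ₁ ^ 2)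
    (hb : σ ^ 2 + b ^ 2 = A.σ₂ ^ 2) (hab : a * b = σ ^ 2) (B : Multiset α) (x : α)
    (θ : Table c d) :
    IsPostProcessing (A.stepLaw (x ::ₘ B) θ) (A.stepLaw B θ) (gauss 1 σ) (gauss 0 σ) := by
  have h := fun k => A.map_stepSim hgrad hC₁ hC₂ ha hb hab B x θ k
  have h0 := h 0
  have h1 := h 1
  simp only [Nat.cast_zero, Nat.cast_one, Multiset.replicate_zero, zero_add,
    Multiset.replicate_one, Multiset.singleton_add] at h0 h1
  rw [← h0, ← h1]
  exact (IsPostProcessing.prod_noise _ _ _).map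
    (A.measurable_stepSim hgrad a b B x measurable_const measurable_id)

lemma isPostProcessing_transcriptLaw (A : AdaFEST α c d) (hgrad : ∀ x, Measurable (A.grad x))
    (hC₁ : 0 < A.C₁) (hC₂ : 0 < A.C₂) {σ a b : ℝ} (ha : σ ^ 2 + a ^ 2 = A.σ₁ ^ 2)
    (hb : σ ^ 2 + b ^ 2 = A.σ₂ ^ 2) (hab : a * b = σ ^ 2) (γ : unitInterval)
    (μ₀ : Measure (Table c d)) [IsProbabilityMeasure μ₀] {n : ℕ} (D : Fin (n + 1) → α)
    (i : Fin (n + 1)) (T : ℕ) :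
    IsPostProcessing (A.transcriptLaw γ μ₀ D T) (A.transcriptLaw γ μ₀ (i.removeNth D) T)
      (prodPow (gaussMixture γ σ) T) (prodPow (gauss 0 σ) T) := by
  induction T with
  | zero =>
    have := A.isProbabilityMeasure_transcriptLaw hgrad γ μ₀ D 0
    have h : A.transcriptLaw γ μ₀ (i.removeNth D) 0 = A.transcriptLaw γ μ₀ D 0 := rfl
    rw [h]
    exact .const _ _ _
  | succ T ih =>
    have := A.isProbabilityMeasure_transcriptLaw hgrad γ μ₀ D T
    have := A.isProbabilityMeasure_transcriptLaw hgrad γ μ₀ (i.removeNth D) T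
    have hparams (N : Type) [MeasurableSpace N] :
        Measurable fun q : Transcript c d T × N => A.params q.1 :=
      (A.measurable_params T).comp measurable_fst
    have hr (B : Multiset α) : Measurable fun q : Transcript c d T × (BucketVec c × Table c d) =>
        A.step B (A.params q.1) q.2.1 q.2.2 :=
      A.measurable_step hgrad B (hparams _) measurable_snd.fst measurable_snd.snd
    have hΦ (B : Multiset α) : Measurable fun q : Transcript c d T ×
        (ℝ × (ℝ × BucketVec c × Table c d)) =>
        A.stepSim a b B (D i) (A.params q.1) q.2 :=
      A.measurable_stepSim hgrad a b B (D i) (hparams _) measurable_snd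
    have hlaw (h : Transcript c d T) (k : ℕ) (B : Multiset α) :=
      (A.map_stepSim hgrad hC₁ hC₂ ha hb hab B (D i) (A.params h) k).symm
    exact IsPostProcessing.subsampled_step (X := Table c d) (Y := BucketVec c × Table c d)
      (N := BucketVec c × Table c d) (W := ℝ × BucketVec c × Table c d) γ σ D i ih
      (r := fun B (h : Transcript c d T) z => A.step B (A.params h) z.1 z.2)
      (Φ := fun B (h : Transcript c d T) p => A.stepSim a b B (D i) (A.params h) p)
      hr hΦ hlaw

/-- If the releases do not depend on the batch, the transcript does not depend on the data. -/
lemma transcriptLaw_eq_of_step_eq (A : AdaFEST α c d) (hgrad : ∀ x, Measurable (A.grad x))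
    (hstep : ∀ B, A.step B = A.step 0) (γ : unitInterval) (μ₀ : Measure (Table c d))
    [IsProbabilityMeasure μ₀] {n m : ℕ} (D : Fin n → α) (D' : Fin m → α) :
    ∀ T, A.transcriptLaw γ μ₀ D T = A.transcriptLaw γ μ₀ D' T
  | 0 => rfl
  | T + 1 => by
    have := A.isProbabilityMeasure_transcriptLaw hgrad γ μ₀ D' T
    have key {l : ℕ} (D'' : Fin l → α) (h : Transcript c d T) :
        ((inclusionLaw γ l).prod ((stdGaussian (BucketVec c)).prod
          (stdGaussian (Table c d)))).map
          (fun p => A.extend (minibatch D'' p.1) p.2.1 p.2.2 h) =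
        ((stdGaussian (BucketVec c)).prod (stdGaussian (Table c d))).map
          (fun z => A.extend 0 z.1 z.2 h) := by
      have hm : Measurable fun z : BucketVec c × Table c d => A.extend 0 z.1 z.2 h :=
        A.measurable_extend hgrad 0 measurable_fst measurable_snd measurable_const
      have hs : Measure.map Prod.snd ((inclusionLaw γ l).prod ((stdGaussian (BucketVec c)).prod
          (stdGaussian (Table c d)))) = (stdGaussian (BucketVec c)).prod
          (stdGaussian (Table c d)) := measurePreserving_snd.map_eq
      conv_rhs => rw [← hs, Measure.map_map hm measurable_snd]
      congr 1
      funext p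
      simp only [extend, hstep (minibatch D'' p.1), Function.comp_apply]
    rw [transcriptLaw, transcriptLaw, A.transcriptLaw_eq_of_step_eq hgrad hstep γ μ₀ D D' T]
    exact map_prod_congr _ _ _ (A.measurable_extend_minibatch hgrad T D)
      (A.measurable_extend_minibatch hgrad T D') fun h => (key D h).trans (key D' h).symm

end AdaFEST

/-! ### DP-SGD -/

namespace DPSGD

variable {α ι : Type*} [Fintype ι]

/-- The private gradient of `B` at `θ`, with a scalar carrying the contribution of one more example
`x`: a scalar drawn from `N(k, σ²)` simulates the batch with `k` extra copies of `x`. -/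
noncomputable def gradSim (A : DPSGD α ι) (B : Multiset α) (x : α) (θ : EuclideanSpace ℝ ι)
    (p : ℝ × EuclideanSpace ℝ ι) : EuclideanSpace ℝ ι :=
  (A.b : ℝ)⁻¹ • ((B.map fun y => clip A.C (A.grad y θ)).sum +
    A.C • spread A.σ (A.C⁻¹ • clip A.C (A.grad x θ)) p)

section Measurability

variable {X : Type*} [MeasurableSpace X] {θ : X → EuclideanSpace ℝ ι}

lemma measurable_noisyGrad (A : DPSGD α ι) (hgrad : ∀ x, Measurable (A.grad x)) (B : Multiset α)
    {z : X → EuclideanSpace ℝ ι} (hθ : Measurable θ) (hz : Measurable z) :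
    Measurable fun q => A.noisyGrad B (θ q) (z q) := by
  have h := measurable_add_smul (measurable_sum_map B fun y =>
    (measurable_clip A.C).comp ((hgrad y).comp hθ)) (hz.const_smul A.σ) A.C
  exact h.const_smul (A.b : ℝ)⁻¹

lemma measurable_gradSim (A : DPSGD α ι) (hgrad : ∀ x, Measurable (A.grad x)) (B : Multiset α)
    (x : α) {p : X → ℝ × EuclideanSpace ℝ ι} (hθ : Measurable θ) (hp : Measurable p) :
    Measurable fun q => A.gradSim B x (θ q) (p q) := by
  have hc (y : α) : Measurable fun q => clip A.C (A.grad y (θ q)) :=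
    (measurable_clip A.C).comp ((hgrad y).comp hθ)
  have h := measurable_add_smul (measurable_sum_map B hc)
    (measurable_spread A.σ ((hc x).const_smul A.C⁻¹) hp) A.C
  exact h.const_smul (A.b : ℝ)⁻¹

end Measurability

lemma map_gradSim (A : DPSGD α ι) (hC : 0 < A.C) (B : Multiset α) (x : α)
    (θ : EuclideanSpace ℝ ι) (k : ℕ) :
    ((gauss k A.σ).prod (stdGaussian (EuclideanSpace ℝ ι))).map (A.gradSim B x θ) =
      (stdGaussian (EuclideanSpace ℝ ι)).map (A.noisyGrad (Multiset.replicate k x + B) θ) := by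
  unfold gradSim
  rw [map_comp_spread k A.σ (norm_inv_smul_clip_le hC (A.grad x θ))
    (F := fun v => (A.b : ℝ)⁻¹ • ((B.map fun y => clip A.C (A.grad y θ)).sum + A.C • v))
    (by fun_prop)]
  congr 1
  funext w
  rw [noisyGrad, sum_map_replicate_add, smul_add A.C, ← add_assoc, smul_comm A.C,
    smul_inv_smul₀ hC.ne', Nat.cast_smul_eq_nsmul]

lemma measurable_params (A : DPSGD α ι) (T : ℕ) :
    Measurable (A.params : Transcript ι T → EuclideanSpace ℝ ι) := by
  unfold params
  fun_prop

lemma measurable_extend_minibatch (A : DPSGD α ι) (hgrad : ∀ x, Measurable (A.grad x))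
    (T : ℕ) {n : ℕ} (D : Fin n → α) :
    Measurable fun p : Transcript ι T × ((Fin n → Bool) × EuclideanSpace ℝ ι) =>
      A.extend (minibatch D p.2.1) p.2.2 p.1 :=
  measurable_comp_discrete measurable_snd.fst fun s => measurable_append measurable_fst
    (A.measurable_noisyGrad hgrad (minibatch D s) ((A.measurable_params T).comp measurable_fst)
      measurable_snd.snd)

lemma isProbabilityMeasure_transcriptLaw (A : DPSGD α ι) (hgrad : ∀ x, Measurable (A.grad x))
    (γ : unitInterval) (μ₀ : Measure (EuclideanSpace ℝ ι)) [IsProbabilityMeasure μ₀] {n : ℕ}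
    (D : Fin n → α) (T : ℕ) : IsProbabilityMeasure (A.transcriptLaw γ μ₀ D T) := by
  induction T with
  | zero => exact Measure.isProbabilityMeasure_map (by fun_prop)
  | succ T ih =>
    exact Measure.isProbabilityMeasure_map
      (A.measurable_extend_minibatch hgrad T D).aemeasurable

lemma isPostProcessing_transcriptLaw (A : DPSGD α ι) (hgrad : ∀ x, Measurable (A.grad x))
    (hC : 0 < A.C) (γ : unitInterval) (μ₀ : Measure (EuclideanSpace ℝ ι))
    [IsProbabilityMeasure μ₀] {n : ℕ} (D : Fin (n + 1) → α) (i : Fin (n + 1)) (T : ℕ) :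
    IsPostProcessing (A.transcriptLaw γ μ₀ D T) (A.transcriptLaw γ μ₀ (i.removeNth D) T)
      (prodPow (gaussMixture γ A.σ) T) (prodPow (gauss 0 A.σ) T) := by
  induction T with
  | zero =>
    have := A.isProbabilityMeasure_transcriptLaw hgrad γ μ₀ D 0
    have h : A.transcriptLaw γ μ₀ (i.removeNth D) 0 = A.transcriptLaw γ μ₀ D 0 := rfl
    rw [h]
    exact .const _ _ _
  | succ T ih =>
    have := A.isProbabilityMeasure_transcriptLaw hgrad γ μ₀ D T
    have := A.isProbabilityMeasure_transcriptLaw hgrad γ μ₀ (i.removeNth D) T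
    have hr (B : Multiset α) : Measurable fun q : Transcript ι T × EuclideanSpace ℝ ι =>
        A.noisyGrad B (A.params q.1) q.2 :=
      A.measurable_noisyGrad hgrad B ((A.measurable_params T).comp measurable_fst) measurable_snd
    have hΦ (B : Multiset α) : Measurable fun q : Transcript ι T × (ℝ × EuclideanSpace ℝ ι) =>
        A.gradSim B (D i) (A.params q.1) q.2 :=
      A.measurable_gradSim hgrad B (D i) ((A.measurable_params T).comp measurable_fst)
        measurable_snd
    have hlaw (h : Transcript ι T) (k : ℕ) (B : Multiset α) :=
      (A.map_gradSim hC B (D i) (A.params h) k).symm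
    exact IsPostProcessing.subsampled_step (X := EuclideanSpace ℝ ι) (Y := EuclideanSpace ℝ ι)
      (N := EuclideanSpace ℝ ι) (W := EuclideanSpace ℝ ι) γ A.σ D i ih
      (r := fun B (h : Transcript ι T) z => A.noisyGrad B (A.params h) z)
      (Φ := fun B (h : Transcript ι T) p => A.gradSim B (D i) (A.params h) p)
      hr hΦ hlaw

end DPSGD

/-! ### Constant gradients attain the dominating pair -/

section ConstantGradient

variable {α ι : Type*} [Fintype ι]

lemma map_snoc_prodPow (R : Measure ℝ) [SigmaFinite R] (T : ℕ) :
    ((prodPow R T).prod R).map (fun p => Fin.snoc (α := fun _ => ℝ) p.1 p.2) =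
      prodPow R (T + 1) := by
  have h := (measurePreserving_piFinSuccAbove (fun _ : Fin (T + 1) => R)
    (Fin.last T)).symm.map_eq
  have hs : ((prodPow R T).prod R).map Prod.swap = R.prod (prodPow R T) := Measure.prod_swap
  have e : (fun p : (Fin T → ℝ) × ℝ => Fin.snoc (α := fun _ => ℝ) p.1 p.2) =
      (MeasurableEquiv.piFinSuccAbove (fun _ => ℝ) (Fin.last T)).symm ∘ Prod.swap := by
    funext p
    exact (Fin.insertNth_last' p.2 p.1).symm
  rw [e, ← Measure.map_map (MeasurableEquiv.measurable _) measurable_swap, hs]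
  exact h

lemma map_eval_stdGaussian (p : ι) (σ : ℝ) :
    (stdGaussian (EuclideanSpace ℝ ι)).map (fun z => σ * z p) = gauss 0 σ := by
  rw [← map_pi_eq_stdGaussian, Measure.map_map (by fun_prop) (by fun_prop)]
  have h := (measurePreserving_eval (fun _ : ι => gaussianReal 0 1) p).map_eq
  have e : (fun z : EuclideanSpace ℝ ι => σ * z p) ∘ WithLp.toLp 2 =
      (fun x => σ * x) ∘ Function.eval p := rfl
  rw [e, ← Measure.map_map (by fun_prop) (by fun_prop), h, gaussianReal_map_const_mul, gauss]
  simp only [mul_zero, mul_one]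
  congr 1
  ext
  simp [sq_nonneg]

lemma map_add_eval_stdGaussian (p : ι) (σ a : ℝ) :
    (stdGaussian (EuclideanSpace ℝ ι)).map (fun z => a + σ * z p) = gauss a σ := by
  have e : (fun z : EuclideanSpace ℝ ι => a + σ * z p) =
      (fun x => a + x) ∘ (fun z => σ * z p) := rfl
  rw [e, ← Measure.map_map (by fun_prop) (by fun_prop), map_eval_stdGaussian, gauss,
    gaussianReal_map_const_add, zero_add, gauss]

/-- Constant gradients of norm `C` along the coordinate axis `p`: that coordinate of the private
gradient, rescaled, counts the mini-batch with normal noise, in every step afresh. -/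
lemma DPSGD.map_transcriptLaw_const [DecidableEq ι] {η C σ : ℝ} {b : ℕ} (hC : 0 < C)
    (hb : 0 < b) (p : ι)
    (γ : unitInterval) (μ₀ : Measure (EuclideanSpace ℝ ι)) [IsProbabilityMeasure μ₀] {n : ℕ}
    (D : Fin n → α) (R : Measure ℝ) [IsProbabilityMeasure R]
    (hR : ((inclusionLaw γ n).prod (stdGaussian (EuclideanSpace ℝ ι))).map
      (fun q => ((minibatch D q.1).card : ℝ) + σ * q.2 p) = R) (T : ℕ) :
    ((DPSGD.mk η C σ b fun (_ : α) _ => EuclideanSpace.single p C).transcriptLaw γ μ₀ D T).map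
      (fun h t => b / C * (h.2 t) p) = prodPow R T := by
  set A : DPSGD α ι := DPSGD.mk η C σ b fun _ _ => EuclideanSpace.single p C with hA
  have hgrad (x : α) : Measurable (A.grad x) := measurable_const
  have hcoord (B : Multiset α) (θ z : EuclideanSpace ℝ ι) :
      b / C * (A.noisyGrad B θ z) p = (B.card : ℝ) + σ * z p := by
    have hclip : clip C (EuclideanSpace.single p C) = EuclideanSpace.single p C :=
      clip_eq_self hC (by simp [abs_of_pos hC])
    have hb' : (b : ℝ) ≠ 0 := by positivity
    simp [DPSGD.noisyGrad, hA, hclip, Multiset.map_const', Multiset.sum_replicate]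
    field_simp
  induction T with
  | zero =>
    have := A.isProbabilityMeasure_transcriptLaw hgrad γ μ₀ D 0
    have := Measure.isProbabilityMeasure_map (μ := A.transcriptLaw γ μ₀ D 0)
      (f := fun h (t : Fin 0) => b / C * (h.2 t) p) (by fun_prop)
    ext s _
    obtain rfl | hs := s.eq_empty_or_nonempty
    · simp
    · rw [hs.eq_univ, measure_univ, measure_univ]
  | succ T ih =>
    have := A.isProbabilityMeasure_transcriptLaw hgrad γ μ₀ D T
    have hm : Measurable fun q : (Fin n → Bool) × EuclideanSpace ℝ ι =>
        ((minibatch D q.1).card : ℝ) + σ * q.2 p :=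
      measurable_from_prod_countable_right fun s => by
        dsimp only
        fun_prop
    have hm' : Measurable fun (h : DPSGD.Transcript ι T) (t : Fin T) => b / C * (h.2 t) p := by
      fun_prop
    rw [← map_snoc_prodPow, ← ih, ← hR, Measure.map_prod_map _ _ hm' hm,
      Measure.map_map (measurable_snoc T) (hm'.prodMap hm), DPSGD.transcriptLaw,
      Measure.map_map (by fun_prop) (A.measurable_extend_minibatch hgrad T D)]
    congr 1
    funext q t
    induction t using Fin.lastCases with
    | last => simp [DPSGD.extend, hcoord]
    | cast j => simp [DPSGD.extend]

end ConstantGradient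

/-! ### Transfer of privacy guarantees -/

lemma isDP_of_isPostProcessing {α Ω Ω₀ : Type*} [MeasurableSpace Ω] [MeasurableSpace Ω₀]
    {M : (n : ℕ) → (Fin n → α) → Measure Ω} (hM : ∀ n D, IsProbabilityMeasure (M n D))
    {P Q : Measure Ω₀} [IsFiniteMeasure P] [IsFiniteMeasure Q]
    (h : ∀ n (D : Fin (n + 1) → α) (i : Fin (n + 1)),
      IsPostProcessing (M (n + 1) D) (M n (i.removeNth D)) P Q) {ε δ : ℝ}
    (hδ : max (hockeyStick ε P Q) (hockeyStick ε Q P) ≤ δ) : IsDP ε δ M := by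
  intro n D i S hS
  have h₁ := sub_le_hockeyStick ε (M (n + 1) D) (M n (i.removeNth D)) hS
  have h₂ := sub_le_hockeyStick ε (M n (i.removeNth D)) (M (n + 1) D) hS
  have h₃ := (h n D i).dominatedBy ε
  have h₄ := (h n D i).symm.dominatedBy ε
  have h₅ := (le_max_left _ _).trans hδ
  have h₆ := (le_max_right _ _).trans hδ
  constructor <;> linarith

/-- A mechanism whose law does not depend on the data at all is `(ε, δ)`-DP as soon as some
mechanism with probability laws is. -/
lemma isDP_of_forall_eq {α Ω Ω₀ : Type*} [MeasurableSpace Ω] [MeasurableSpace Ω₀]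
    {M : (n : ℕ) → (Fin n → α) → Measure Ω} (hM : ∀ n D, IsProbabilityMeasure (M n D))
    (h : ∀ n m (D : Fin n → α) (D' : Fin m → α), M n D = M m D')
    {M' : (n : ℕ) → (Fin n → α) → Measure Ω₀} (hM' : ∀ n D, IsProbabilityMeasure (M' n D))
    {ε δ : ℝ} (hDP : IsDP ε δ M') : IsDP ε δ M := by
  intro n D i S hS
  rw [h (n + 1) n D (i.removeNth D), and_self]
  have h₀ := (hDP n D i ∅ .empty).1
  have h₁ := (hDP n D i Set.univ .univ).1
  simp only [measureReal_empty, mul_zero, zero_add, probReal_univ, mul_one] at h₀ h₁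
  have hS₀ : 0 ≤ (M n (i.removeNth D)).real S := measureReal_nonneg
  have hS₁ : (M n (i.removeNth D)).real S ≤ 1 := measureReal_le_one
  -- the guarantee for the events `∅` and `univ` says that `0 ≤ δ` and `1 - exp ε ≤ δ`
  nlinarith

namespace AdaFEST

variable {α : Type*} {c d : ℕ}

/-- An empty table carries no gradients. -/
lemma step_eq_of_isEmpty [IsEmpty (Fin c × Fin d)] (A : AdaFEST α c d) (B : Multiset α) :
    A.step B = A.step 0 := by
  have h0 (g : Table c d) : contributionMap g = 0 := by
    ext j
    have : ¬ ∃ k, g (j, k) ≠ 0 := fun ⟨k, _⟩ => isEmptyElim (j, k)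
    simp [contributionMap, this]
  have hmap : A.noisyMap B = A.noisyMap 0 := by
    funext θ z
    simp [noisyMap, h0, clip]
  funext θ z₁ z₂
  exact Prod.ext (by simp only [step, hmap]) (Subsingleton.elim _ _)

lemma isProbabilityMeasure_outputLaw (A : AdaFEST α c d) (hgrad : ∀ x, Measurable (A.grad x))
    (γ : unitInterval) (μ₀ : Measure (Table c d)) [IsProbabilityMeasure μ₀] {n : ℕ}
    (D : Fin n → α) (T : ℕ) : IsProbabilityMeasure (A.outputLaw γ μ₀ T D) := by
  have := A.isProbabilityMeasure_transcriptLaw hgrad γ μ₀ D T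
  exact Measure.isProbabilityMeasure_map (A.measurable_params T).aemeasurable

/-- The output is a function of the transcript. -/
lemma isPostProcessing_outputLaw (A : AdaFEST α c d) (γ : unitInterval)
    (μ₀ : Measure (Table c d)) {n m : ℕ} {D : Fin n → α} {D' : Fin m → α} {T : ℕ}
    {Ω : Type*} [MeasurableSpace Ω] {P Q : Measure Ω}
    (h : IsPostProcessing (A.transcriptLaw γ μ₀ D T) (A.transcriptLaw γ μ₀ D' T) P Q) :
    IsPostProcessing (A.outputLaw γ μ₀ T D) (A.outputLaw γ μ₀ T D') P Q :=
  h.map (A.measurable_params T)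

end AdaFEST

/-- On a nonempty table, privacy of DP-SGD for constant gradients bounds the divergences of the
dominating pair: the datasets are a single example and the empty one. -/
lemma DPSGD.max_hockeyStick_le_of_isDP {α ι : Type*} [Fintype ι] [DecidableEq ι] (x : α) (p : ι)
    {η C σ : ℝ} {b : ℕ} (hC : 0 < C) (hb : 0 < b) (γ : unitInterval)
    (μ₀ : Measure (EuclideanSpace ℝ ι)) [IsProbabilityMeasure μ₀] (T : ℕ) {ε δ : ℝ}
    (h : IsDP ε δ fun _ (D : Fin _ → α) => (DPSGD.mk η C σ b
      fun (_ : α) _ => EuclideanSpace.single p C).transcriptLaw γ μ₀ D T) :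
    max (hockeyStick ε (prodPow (gaussMixture γ σ) T) (prodPow (gauss 0 σ) T))
      (hockeyStick ε (prodPow (gauss 0 σ) T) (prodPow (gaussMixture γ σ) T)) ≤ δ := by
  set A : DPSGD α ι := DPSGD.mk η C σ b fun _ _ => EuclideanSpace.single p C with hA
  have hgrad (x : α) : Measurable (A.grad x) := measurable_const
  let D : Fin 1 → α := fun _ => x
  have h₁ : (A.transcriptLaw γ μ₀ D T).map (fun h t => b / C * (h.2 t) p) =
      prodPow (gaussMixture γ σ) T := by
    refine map_transcriptLaw_const hC hb p γ μ₀ D _ ?_ T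
    have hr (B : Multiset α) :
        Measurable fun z : EuclideanSpace ℝ ι => (B.card : ℝ) + σ * z p := by fun_prop
    rw [map_subsample_of_mem γ σ D 0 (ν := Measure.dirac ())
      (r := fun B (z : EuclideanSpace ℝ ι) => (B.card : ℝ) + σ * z p)
      (Φ := fun B q => (B.card : ℝ) + q.1) hr (fun B => by fun_prop)]
    · simp [minibatch, measurePreserving_fst.map_eq]
    · intro k B
      have e : (fun q : ℝ × Unit => (B.card : ℝ) + q.1) = (fun y : ℝ => B.card + y) ∘ Prod.fst :=
        rfl
      rw [map_add_eval_stdGaussian, e, ← Measure.map_map (by fun_prop) measurable_fst,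
        measurePreserving_fst.map_eq, gauss, gauss, gaussianReal_map_const_add]
      simp
  have h₀ : (A.transcriptLaw γ μ₀ ((0 : Fin 1).removeNth D) T).map
      (fun h t => b / C * (h.2 t) p) = prodPow (gauss 0 σ) T := by
    refine map_transcriptLaw_const hC hb p γ μ₀ ((0 : Fin 1).removeNth D) _ ?_ T
    have e : (fun q : (Fin 0 → Bool) × EuclideanSpace ℝ ι =>
        ((minibatch ((0 : Fin 1).removeNth D) q.1).card : ℝ) + σ * q.2 p) =
        (fun z => σ * z p) ∘ Prod.snd := by
      funext q
      simp [minibatch]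
    rw [e, ← Measure.map_map (by fun_prop) measurable_snd, measurePreserving_snd.map_eq,
      map_eval_stdGaussian]
  have hpost : IsPostProcessing (prodPow (gaussMixture γ σ) T) (prodPow (gauss 0 σ) T)
      (A.transcriptLaw γ μ₀ D T) (A.transcriptLaw γ μ₀ ((0 : Fin 1).removeNth D) T) :=
    .of_map (by fun_prop) h₁ h₀
  have := A.isProbabilityMeasure_transcriptLaw hgrad γ μ₀ D T
  have := A.isProbabilityMeasure_transcriptLaw hgrad γ μ₀ ((0 : Fin 1).removeNth D) T
  exact max_le
    ((hpost.dominatedBy ε).trans (hockeyStick_le fun S hS => (h 0 D 0 S hS).1))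
    ((hpost.symm.dominatedBy ε).trans (hockeyStick_le fun S hS => (h 0 D 0 S hS).2))

end DPTraining

open DPTraining MeasureTheory in
theorem mainTheorem1 {α : Type*} {c d : ℕ}
    (A : AdaFEST α c d) (hgrad : ∀ x, Measurable (A.grad x))
    (hC₁ : 0 < A.C₁) (hC₂ : 0 < A.C₂) (hσ₁ : 0 < A.σ₁) (hσ₂ : 0 < A.σ₂)
    (γ : unitInterval) (hγ : 0 < γ) (T : ℕ)
    (μ₀ : Measure (Table c d)) [IsProbabilityMeasure μ₀]
    (σ : ℝ) (hσ : σ = (A.σ₁ ^ (-2 : ℝ) + A.σ₂ ^ (-2 : ℝ)) ^ (-1 / 2 : ℝ)) :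
    -- the noisy contribution map: a Gaussian mechanism with noise multiplier `σ₁`
    (∀ (B : Multiset α) (x : α) (θ : Table c d),
      DominatedBy (A.mapLaw (x ::ₘ B) θ) (A.mapLaw B θ) (gauss 1 A.σ₁) (gauss 0 A.σ₁) ∧
      DominatedBy (A.mapLaw B θ) (A.mapLaw (x ::ₘ B) θ) (gauss 1 A.σ₁) (gauss 0 A.σ₁)) ∧
    -- the masked noisy gradient, for every value of the map: noise multiplier `σ₂`
    (∀ (B : Multiset α) (x : α) (θ : Table c d) (V : BucketVec c),
      DominatedBy (A.gradLaw (x ::ₘ B) θ V) (A.gradLaw B θ V) (gauss 1 A.σ₂) (gauss 0 A.σ₂) ∧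
      DominatedBy (A.gradLaw B θ V) (A.gradLaw (x ::ₘ B) θ V) (gauss 1 A.σ₂) (gauss 0 A.σ₂)) ∧
    -- two Gaussian mechanisms composed are equivalent to one with noise multiplier `σ`
    (∀ ε : ℝ,
      hockeyStick ε ((gauss 1 A.σ₁).prod (gauss 1 A.σ₂)) ((gauss 0 A.σ₁).prod (gauss 0 A.σ₂)) =
        hockeyStick ε (gauss 1 σ) (gauss 0 σ)) ∧
    -- one step of the algorithm, that is, the adaptive composition
    (∀ (B : Multiset α) (x : α) (θ : Table c d),
      DominatedBy (A.stepLaw (x ::ₘ B) θ) (A.stepLaw B θ) (gauss 1 σ) (gauss 0 σ) ∧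
      DominatedBy (A.stepLaw B θ) (A.stepLaw (x ::ₘ B) θ) (gauss 1 σ) (gauss 0 σ)) ∧
    -- `T` steps with Poisson subsampling: everything released, and the trained parameters
    (∀ (n : ℕ) (D : Fin (n + 1) → α) (i : Fin (n + 1)),
      DominatedBy (A.transcriptLaw γ μ₀ D T) (A.transcriptLaw γ μ₀ (i.removeNth D) T)
        (prodPow (gaussMixture γ σ) T) (prodPow (gauss 0 σ) T) ∧
      DominatedBy (A.transcriptLaw γ μ₀ (i.removeNth D) T) (A.transcriptLaw γ μ₀ D T)
        (prodPow (gauss 0 σ) T) (prodPow (gaussMixture γ σ) T) ∧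
      DominatedBy (A.outputLaw γ μ₀ T D) (A.outputLaw γ μ₀ T (i.removeNth D))
        (prodPow (gaussMixture γ σ) T) (prodPow (gauss 0 σ) T) ∧
      DominatedBy (A.outputLaw γ μ₀ T (i.removeNth D)) (A.outputLaw γ μ₀ T D)
        (prodPow (gauss 0 σ) T) (prodPow (gaussMixture γ σ) T)) ∧
    -- DP-SGD with noise multiplier `σ`, the same rate and number of steps: the same pair
    (∀ (m : ℕ) (A' : DPSGD α (Fin m)) (ν₀ : Measure (EuclideanSpace ℝ (Fin m))),
      IsProbabilityMeasure ν₀ → (∀ x, Measurable (A'.grad x)) → 0 < A'.C → 0 < A'.b → A'.σ = σ →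
      ∀ (n : ℕ) (D : Fin (n + 1) → α) (i : Fin (n + 1)),
        DominatedBy (A'.transcriptLaw γ ν₀ D T) (A'.transcriptLaw γ ν₀ (i.removeNth D) T)
          (prodPow (gaussMixture γ σ) T) (prodPow (gauss 0 σ) T) ∧
        DominatedBy (A'.transcriptLaw γ ν₀ (i.removeNth D) T) (A'.transcriptLaw γ ν₀ D T)
          (prodPow (gauss 0 σ) T) (prodPow (gaussMixture γ σ) T)) ∧
    -- hence the same sufficient condition for `(ε, δ)`-DP
    (∀ ε δ : ℝ,
      max (hockeyStick ε (prodPow (gaussMixture γ σ) T) (prodPow (gauss 0 σ) T))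
        (hockeyStick ε (prodPow (gauss 0 σ) T) (prodPow (gaussMixture γ σ) T)) ≤ δ →
      IsDP ε δ (fun _ (D : Fin _ → α) => A.transcriptLaw γ μ₀ D T) ∧
      IsDP ε δ (fun _ (D : Fin _ → α) => A.outputLaw γ μ₀ T D)) ∧
    -- and every `(ε, δ)`-guarantee of DP-SGD with noise multiplier `σ` is one of DP-AdaFEST
    (∀ (η C : ℝ) (b : ℕ), 0 < C → 0 < b → ∀ ε δ : ℝ,
      (∀ g : α → Table c d → Table c d, (∀ x, Measurable (g x)) →
        IsDP ε δ (fun _ (D : Fin _ → α) =>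
          (DPSGD.mk η C σ b g).transcriptLaw γ μ₀ D T)) →
      IsDP ε δ (fun _ (D : Fin _ → α) => A.transcriptLaw γ μ₀ D T) ∧
      IsDP ε δ (fun _ (D : Fin _ → α) => A.outputLaw γ μ₀ T D)) := by
  obtain ⟨hmean, a, b, ha, hb, hab⟩ := AdaFEST.exists_split hσ₁ hσ₂ hσ
  have htrans (n : ℕ) (D : Fin (n + 1) → α) (i : Fin (n + 1)) :=
    A.isPostProcessing_transcriptLaw hgrad hC₁ hC₂ ha hb hab γ μ₀ D i T
  have hout (n : ℕ) (D : Fin (n + 1) → α) (i : Fin (n + 1)) :=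
    A.isPostProcessing_outputLaw γ μ₀ (htrans n D i)
  have hprob (n : ℕ) (D : Fin n → α) := A.isProbabilityMeasure_transcriptLaw hgrad γ μ₀ D T
  have hprob' (n : ℕ) (D : Fin n → α) := A.isProbabilityMeasure_outputLaw hgrad γ μ₀ D T
  have hDP (ε δ : ℝ)
      (hδ : max (hockeyStick ε (prodPow (gaussMixture γ σ) T) (prodPow (gauss 0 σ) T))
        (hockeyStick ε (prodPow (gauss 0 σ) T) (prodPow (gaussMixture γ σ) T)) ≤ δ) :
      IsDP ε δ (fun _ (D : Fin _ → α) => A.transcriptLaw γ μ₀ D T) ∧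
      IsDP ε δ (fun _ (D : Fin _ → α) => A.outputLaw γ μ₀ T D) :=
    ⟨isDP_of_isPostProcessing hprob htrans hδ, isDP_of_isPostProcessing hprob' hout hδ⟩
  refine ⟨fun B x θ => ?_, fun B x θ V => ?_, fun ε => le_antisymm ?_ ?_, fun B x θ => ?_,
    fun n D i => ⟨(htrans n D i).dominatedBy, (htrans n D i).symm.dominatedBy,
      (hout n D i).dominatedBy, (hout n D i).symm.dominatedBy⟩,
    fun m A' ν₀ _ hgrad' hC' _ hσ' n D i => ?_, hDP, fun η C b' hC hb' ε δ h => ?_⟩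
  · have h := A.isPostProcessing_mapLaw hgrad hC₁ B x θ
    exact ⟨h.dominatedBy, h.of_gauss_swap.dominatedBy⟩
  · have h := A.isPostProcessing_gradLaw hgrad hC₂ B x θ V
    exact ⟨h.dominatedBy, h.of_gauss_swap.dominatedBy⟩
  · rw [← map_split ha hb hab 1, ← map_split ha hb hab 0]
    exact ((IsPostProcessing.prod_noise (gauss 1 σ) (gauss 0 σ) (gauss 0 1)).map
      (by fun_prop)).dominatedBy ε
  · exact (IsPostProcessing.of_map (by fun_prop) (map_weightedMean hσ₁.ne' hσ₂.ne' hmean 1)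
      (map_weightedMean hσ₁.ne' hσ₂.ne' hmean 0)).dominatedBy ε
  · have h := A.isPostProcessing_stepLaw hgrad hC₁ hC₂ ha hb hab B x θ
    exact ⟨h.dominatedBy, h.of_gauss_swap.dominatedBy⟩
  · have h := A'.isPostProcessing_transcriptLaw hgrad' hC' γ ν₀ D i T
    rw [hσ'] at h
    exact ⟨h.dominatedBy, h.symm.dominatedBy⟩
  · rcases isEmpty_or_nonempty (Fin c × Fin d) with _ | ⟨⟨p⟩⟩
    · have hconst := fun n m (D : Fin n → α) (D' : Fin m → α) =>
        A.transcriptLaw_eq_of_step_eq hgrad A.step_eq_of_isEmpty γ μ₀ D D' T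
      have h0 := h 0 fun x => measurable_const
      have hprob₀ (n : ℕ) (D : Fin n → α) := DPSGD.isProbabilityMeasure_transcriptLaw
        (DPSGD.mk η C σ b' (0 : α → Table c d → Table c d)) (fun _ => measurable_const) γ μ₀ D T
      exact ⟨isDP_of_forall_eq hprob hconst hprob₀ h0,
        isDP_of_forall_eq hprob' (fun n m D D' => by
          rw [AdaFEST.outputLaw, AdaFEST.outputLaw, hconst n m D D']) hprob₀ h0⟩
    · rcases isEmpty_or_nonempty α with _ | ⟨⟨x⟩⟩
      · exact ⟨fun n D i => isEmptyElim (D i), fun n D i => isEmptyElim (D i)⟩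
      · exact hDP ε δ (DPSGD.max_hockeyStick_le_of_isDP x p hC hb' γ μ₀ T
          (h _ fun _ => measurable_const))
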